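/- Let $q\in\mathbb C$ with $0<|q|<1$, and put $\Omega_q:=\{q^{-k}:k=0,1,2,\dots\}$. Write $(a;q)_n:=\prod_{j=0}^{n-1}(1-aq^j)$, $(a;q)_\infty:=\prod_{j\ge 0}(1-aq^j)$, $(a_1,\dots,a_k;q)_n:=\prod_{i}(a_i;q)_n$ (also for $n=\infty$), $\vartheta(x;q):=(x,q/x;q)_\infty$ for $x\ne0$ and $\vartheta(x,y;q):=\vartheta(x;q)\vartheta(y;q)$. A list of parameters inside a symbol stands for all its entries; $x\mathbf a$, $\mathbf a/x$, $x/\mathbf a$ are formed entrywise, and $\mathbf c_{[k]}$ is $\mathbf c$ with $c_k$ removed. Let $${}_{r+1}\phi_s\!\left({a_1,\dots,a_{r+1}\atop b_1,\dots,b_s};q,x\right):=\sum_{k\ge0}\frac{(a_1,\dots,a_{r+1};q)_k}{(q,b_1,\dots,b_s;q)_k}\left((-1)^kq^{\binom k2}\right)^{s-r}x^k ,$$ and for $p\ge 0$ let ${}_{r+1}\phi_s^{-p}$ (resp. ${}_{r+1}\phi_s^{\,p}$) be the series obtained from ${}_{r+1}\phi_s$ by adjoining $p$ further numerator (resp. denominator)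 parameters equal to $0$ (so that the indices $r+1$, $s$ in the defining formula grow accordingly). Let $A,C\ge0$ be integers, $\mathbf a=(a_1,\dots,a_A)$ and $\mathbf c=(c_1,\dots,c_C)$ finite lists of complex numbers, $d_1,d_2,f\in\mathbb C\setminus\{0\}$, $\mathbf d=(d_1,d_2)$ and $\sigma\in(0,\infty)$, with $|c_k|<\sigma$ for all $k$ and $|d_1|,|d_2|<1/\sigma$. With $z=e^{i\psi}$ put $$I:=\int_{-\pi}^{\pi}\frac{\left((fd_1,\frac qf d_2)\frac{\sigma}{z},(\frac f{d_2},\frac q{fd_1},\mathbf a)\frac z\sigma;q\right)_\infty}{\left((d_1,d_2)\frac\sigma z,\mathbf c\frac z\sigma;q\right)_\infty}\,d\psi .$$ The integrand is integrable on $[-\pi,\pi]$, and the following hold. (i) Suppose $d_1/d_2,\,d_2/d_1\notin\Omega_q$ and $d_la_i\notin\Omega_q$ for all $l\in\{1,2\}$ and all $i$. Then both series below converge, and $$I=\frac{2\pi\,\vartheta(f,f\frac{d_1}{d_2};q)}{(q;q)_\infty}\,H,$$ where $$H:=\frac{(d_1\mathbf a;q)_\infty}{(\frac{d_2}{d_1},d_1\mathbf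 c;q)_\infty}\;{}_{C}\phi_{A+1}^{C-A-2}\!\left({d_1\mathbf c\atop d_1\mathbf a,\,qd_1/d_2};q,q\right)+\frac{(d_2\mathbf a;q)_\infty}{(\frac{d_1}{d_2},d_2\mathbf c;q)_\infty}\;{}_{C}\phi_{A+1}^{C-A-2}\!\left({d_2\mathbf c\atop d_2\mathbf a,\,qd_2/d_1};q,q\right).$$ (ii) Suppose $C\ge A+2$, all $a_i$ and $c_k$ are nonzero, $c_k/c_{k'}\notin\Omega_q$ for $k\ne k'$, and, in case $C=A+2$, $|q\,a_1\cdots a_A|<|d_1d_2\,c_1\cdots c_C|$. Then every series below converges (and for $C>A+2$ each ${}_{A+2}\phi_{C-1}$ below, as a function of its argument, converges everywhere and is entire), and $$I=\frac{2\pi}{(q;q)_\infty}\,J,$$ where $$J:=\sum_{k=1}^{C}\frac{\vartheta(fc_kd_1,\frac f{c_kd_2};q)\,(\mathbf a/c_k;q)_\infty}{(c_k\mathbf d,\mathbf c_{[k]}/c_k;q)_\infty}\;{}_{A+2}\phi_{C-1}\!\left({c_k\mathbf d,\,qc_k/\mathbf a\atop qc_k/\mathbf c_{[k]}};q,\frac{q(qc_k)^{C-A-2}a_1\cdots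 a_A}{d_1d_2\,c_1\cdots c_C}\right).$$ -/

import Mathlib

open MeasureTheory

noncomputable section

namespace QHyp

/-- The set `Ω_q = {q^{-k} : k = 0, 1, 2, …}`. -/
def Omega (q : ℂ) : Set ℂ := {x | ∃ k : ℕ, x = (q ^ k)⁻¹}

/-- The finite `q`-shifted factorial `(a;q)_n = (1-a)(1-aq)⋯(1-aq^{n-1})`. -/
def poch (a q : ℂ) (n : ℕ) : ℂ := ∏ j ∈ Finset.range n, (1 - a * q ^ j)

/-- The infinite `q`-shifted factorial `(a;q)_∞`. -/
def pochInf (a q : ℂ) : ℂ := ∏' n : ℕ, (1 - a * q ^ n)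

/-- `(a_1,…,a_k;q)_n` for a finite multiset of parameters. -/
def pochM (S : Multiset ℂ) (q : ℂ) (n : ℕ) : ℂ := (S.map fun x => poch x q n).prod

/-- `(a_1,…,a_k;q)_∞` for a finite multiset of parameters. -/
def pochInfM (S : Multiset ℂ) (q : ℂ) : ℂ := (S.map fun x => pochInf x q).prod

/-- The modified theta function `ϑ(x;q) = (x, q/x; q)_∞`. -/
def theta (x q : ℂ) : ℂ := pochInf x q * pochInf (q / x) q

/-- The `k`-th term of the basic hypergeometric series `_{r+1}φ_s(as; bs; q, z)`, where
`r + 1 = card as` and `s = card bs`, so that `s - r = card bs + 1 - card as`. -/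
def phiTerm (as bs : Multiset ℂ) (q z : ℂ) (k : ℕ) : ℂ :=
  pochM as q k / (poch q q k * pochM bs q k)
    * ((-1) ^ k * q ^ (k.choose 2)) ^ ((Multiset.card bs : ℤ) + 1 - (Multiset.card as : ℤ))
    * z ^ k

/-- The basic hypergeometric series `_{r+1}φ_s(as; bs; q, z)`. -/
def phi (as bs : Multiset ℂ) (q z : ℂ) : ℂ := ∑' k : ℕ, phiTerm as bs q z k

/-- Terms of the series `_{r+1}φ_s^m`: for `m = -p ≤ 0`, `p` zeros are appended to the numerator
parameters; for `m = p ≥ 0`, `p` zeros are appended to the denominator parameters. -/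
def phiZTerm (m : ℤ) (as bs : Multiset ℂ) (q z : ℂ) (k : ℕ) : ℂ :=
  phiTerm (as + Multiset.replicate (-m).toNat 0) (bs + Multiset.replicate m.toNat 0) q z k

/-- The van de Bult--Rains series `_{r+1}φ_s^m(as; bs; q, z)`. -/
def phiZ (m : ℤ) (as bs : Multiset ℂ) (q z : ℂ) : ℂ :=
  phi (as + Multiset.replicate (-m).toNat 0) (bs + Multiset.replicate m.toNat 0) q z

/-- The multiset `{a_1, …, a_n}`. -/
def params {n : ℕ} (a : Fin n → ℂ) : Multiset ℂ := Finset.univ.val.map a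

/-- The multiset `{a_1, …, a_n}` with the entry of index `k` removed. -/
def paramsErase {n : ℕ} (a : Fin n → ℂ) (k : Fin n) : Multiset ℂ :=
  (Finset.univ.erase k).val.map a

/-- `b 𝐚 = {b a_1, …, b a_n}`. -/
def smulM (b : ℂ) (S : Multiset ℂ) : Multiset ℂ := S.map fun x => b * x

/-- `𝐚 / b = {a_1 / b, …, a_n / b}`. -/
def divM (S : Multiset ℂ) (b : ℂ) : Multiset ℂ := S.map fun x => x / b

/-- `b / 𝐚 = {b / a_1, …, b / a_n}`. -/
def divByM (b : ℂ) (S : Multiset ℂ) : Multiset ℂ := S.map fun x => b / x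

/-- The integrand, with `z = e^{iψ}`. -/
def integrand {A C : ℕ} (a : Fin A → ℂ) (c : Fin C → ℂ) (d₁ d₂ f q : ℂ) (σ : ℝ) (ψ : ℝ) : ℂ :=
  let z : ℂ := Complex.exp (Complex.I * ψ)
  (pochInfM (smulM (σ / z) {f * d₁, q / f * d₂}) q
      * pochInfM (smulM (z / σ) ({f / d₂, q / (f * d₁)} + params a)) q)
    / (pochInfM (smulM (σ / z) {d₁, d₂}) q * pochInfM (smulM (z / σ) (params c)) q)

/-- The terms of the argument `q` series in the first summand of `H`. -/
def hTerm {A C : ℕ} (a : Fin A → ℂ) (c : Fin C → ℂ) (d₁ d₂ q : ℂ) (k : ℕ) : ℂ :=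
  phiZTerm ((C : ℤ) - A - 2) (smulM d₁ (params c))
    (smulM d₁ (params a) + {q * d₁ / d₂}) q q k

/-- The first summand of `H`; the second one is obtained by interchanging `d₁` and `d₂`. -/
def hSummand {A C : ℕ} (a : Fin A → ℂ) (c : Fin C → ℂ) (d₁ d₂ q : ℂ) : ℂ :=
  pochInfM (smulM d₁ (params a)) q
    / (pochInf (d₂ / d₁) q * pochInfM (smulM d₁ (params c)) q)
    * phiZ ((C : ℤ) - A - 2) (smulM d₁ (params c))
        (smulM d₁ (params a) + {q * d₁ / d₂}) q q

/-- `H(𝐚, 𝐜, 𝐝; q)`, the symmetric sum over `{d₁, d₂}`. -/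
def H {A C : ℕ} (a : Fin A → ℂ) (c : Fin C → ℂ) (d₁ d₂ q : ℂ) : ℂ :=
  hSummand a c d₁ d₂ q + hSummand a c d₂ d₁ q

/-- Numerator parameters `c_k 𝐝, q c_k / 𝐚` of the `k`-th series in `J`. -/
def jNum {A C : ℕ} (a : Fin A → ℂ) (c : Fin C → ℂ) (d₁ d₂ q : ℂ) (k : Fin C) : Multiset ℂ :=
  smulM (c k) {d₁, d₂} + divByM (q * c k) (params a)

/-- Denominator parameters `q c_k / 𝐜_{[k]}` of the `k`-th series in `J`. -/
def jDen {C : ℕ} (c : Fin C → ℂ) (q : ℂ) (k : Fin C) : Multiset ℂ :=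
  divByM (q * c k) (paramsErase c k)

/-- The argument of the `k`-th series in `J` (used only for `C ≥ A + 2`). -/
def jArg {A C : ℕ} (a : Fin A → ℂ) (c : Fin C → ℂ) (d₁ d₂ q : ℂ) (k : Fin C) : ℂ :=
  q * (q * c k) ^ ((C : ℤ) - A - 2) * (∏ i, a i) / (d₁ * d₂ * ∏ j, c j)

/-- `J(𝐚, 𝐜, 𝐝; f, q)`. -/
def J {A C : ℕ} (a : Fin A → ℂ) (c : Fin C → ℂ) (d₁ d₂ f q : ℂ) : ℂ :=
  ∑ k : Fin C,
    theta (f * c k * d₁) q * theta (f / (c k * d₂)) q * pochInfM (divM (params a) (c k)) q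
      / (pochInfM (smulM (c k) {d₁, d₂}) q * pochInfM (divM (paramsErase c k) (c k)) q)
      * phi (jNum a c d₁ d₂ q k) (jDen c q k) q (jArg a c d₁ d₂ q k)

end QHyp

end

/-
With `w = z / σ` the integral is `2 π` times the mean over a circle of
`ϑ(u w, v / w; q) (P w, Q / w; q)_∞ / (R w, T / w; q)_∞`. Replacing `w` by `w q` multiplies this
function by a rational factor whose limit at `w = 0` has modulus less than one, so its means over
the circles `|w| = ρ |q| ^ n` tend to `0`, and the mean over the first circle is the sum of the
residues at the poles `w = t q ^ n`, `t ∈ T`. By the quasi-periodicity of the `q`-shifted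
factorials the residues along one such sequence are the terms of a basic hypergeometric series.
The poles `w = d_l q ^ n` give `H`; after the substitution `w ↦ 1 / w` the poles `w = c_k q ^ n`
give `J`.
-/

noncomputable section

namespace QHyp

open Filter Topology

section Residue

open Metric Complex

variable {E : Type*} [NormedAddCommGroup E] [NormedSpace ℂ E] {ι : Type*} {F : ℂ → E}
  {s : Finset ι} {p : ι → ℂ} {res : ι → E}

lemma differentiableAt_sub_inv_smul {w p : ℂ} (hw : w ≠ p) (a : E) :
    DifferentiableAt ℂ (fun w => (w - p)⁻¹ • a) w := by
  have hne := sub_ne_zero.2 hw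
  fun_prop (disch := assumption)

lemma tendsto_sub_smul_sub_sum_principalParts (hinj : Set.InjOn p s) {i : ι} (hi : i ∈ s)
    (hres : Tendsto (fun w => (w - p i) • F w) (𝓝[≠] p i) (𝓝 (res i))) :
    Tendsto (fun w => (w - p i) • (F w - ∑ k ∈ s, (w - p k)⁻¹ • res k)) (𝓝[≠] p i) (𝓝 0) := by
  classical
  have hrest : ContinuousAt (fun w => (w - p i) • ∑ k ∈ s.erase i, (w - p k)⁻¹ • res k) (p i) := by
    refine (continuousAt_id.sub continuousAt_const).smul (tendsto_finsetSum _ fun k hk => ?_)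
    obtain ⟨hki, hks⟩ := Finset.mem_erase.1 hk
    exact (differentiableAt_sub_inv_smul (hinj.ne hi hks hki.symm) (res k)).continuousAt
  have hlim := (hres.sub_const (res i)).sub (hrest.tendsto.mono_left nhdsWithin_le_nhds)
  simp only [sub_self, zero_smul] at hlim
  refine hlim.congr' ?_
  filter_upwards [self_mem_nhdsWithin] with w hw
  rw [← Finset.add_sum_erase s _ hi, smul_sub, smul_add, smul_inv_smul₀ (sub_ne_zero.2 hw),
    sub_sub]

variable [CompleteSpace E]

lemma tendsto_limUnder_of_tendsto_sub_smul_zero {p : ℂ}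
    (hd : ∀ᶠ w in 𝓝[≠] p, DifferentiableAt ℂ F w)
    (hF : Tendsto (fun w => (w - p) • F w) (𝓝[≠] p) (𝓝 0)) :
    Tendsto F (𝓝[≠] p) (𝓝 (limUnder (𝓝[≠] p) F)) := by
  refine tendsto_limUnder_of_differentiable_on_punctured_nhds_of_isLittleO hd ?_
  have hsub : Tendsto (fun w => (w - p) • F p) (𝓝[≠] p) (𝓝 0) :=
    (Continuous.tendsto' (f := fun w => (w - p) • F p) (by fun_prop) p 0 (by simp)).mono_left
      nhdsWithin_le_nhds
  have hlim : Tendsto (fun w => (w - p) • (F w - F p)) (𝓝[≠] p) (𝓝 0) := by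
    simpa only [smul_sub, sub_zero] using hF.sub hsub
  have hmul := (Asymptotics.isBigO_refl (fun w : ℂ => (w - p)⁻¹) (𝓝[≠] p)).smul_isLittleO
    ((Asymptotics.isLittleO_one_iff ℂ).2 hlim)
  refine hmul.congr' ?_ (.of_forall fun w => by simp)
  filter_upwards [self_mem_nhdsWithin] with w hw
  exact inv_smul_smul₀ (sub_ne_zero.2 hw) _

lemma circleIntegral_eq_of_removable_singularities {c : ℂ} {r R : ℝ} (hr : 0 < r)
    (hrR : r ≤ R) {s : Set ℂ} (hs : s.Finite) (hsub : s ⊆ ball c R \ closedBall c r)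
    (hd : ∀ w ∈ closedBall c R \ ball c r, w ∉ s → DifferentiableAt ℂ F w)
    (hlim : ∀ p ∈ s, Tendsto (fun w => (w - p) • F w) (𝓝[≠] p) (𝓝 0)) :
    (∮ w in C(c, R), F w) = ∮ w in C(c, r), F w := by
  classical
  set G : ℂ → E := fun w => if w ∈ s then limUnder (𝓝[≠] w) F else F w
  have hGF : Set.EqOn G F sᶜ := fun w hw => if_neg hw
  have hopen : IsOpen (ball c R \ closedBall c r) := isOpen_ball.sdiff isClosed_closedBall
  have hclosed : ball c R \ closedBall c r ⊆ closedBall c R \ ball c r :=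
    Set.sdiff_subset_sdiff ball_subset_closedBall ball_subset_closedBall
  have hGp : ∀ p ∈ s, ContinuousAt G p := by
    intro p hp
    have hoff : ∀ᶠ w in 𝓝[≠] p, w ∉ s := by
      filter_upwards [nhdsNE_of_nhdsNE_sdiff_finite univ_mem hs] with w hw using hw.2
    have hnear : ∀ᶠ w in 𝓝[≠] p, DifferentiableAt ℂ F w := by
      filter_upwards [hoff, nhdsWithin_le_nhds (hopen.mem_nhds (hsub hp))] with w hws hw
      exact hd w (hclosed hw) hws
    rw [continuousAt_iff_punctured_nhds, show G p = limUnder (𝓝[≠] p) F from if_pos hp]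
    exact (tendsto_limUnder_of_tendsto_sub_smul_zero hnear (hlim p hp)).congr'
      (hoff.mono fun w hw => (hGF hw).symm)
  have hG : ∀ w ∈ closedBall c R \ ball c r, w ∉ s → DifferentiableAt ℂ G w := fun w hw hws =>
    (hd w hw hws).congr_of_eventuallyEq
      (hGF.eventuallyEq_of_mem (hs.isClosed.isOpen_compl.mem_nhds hws))
  have hR : ∀ w ∈ sphere c R, G w = F w := fun w hw =>
    hGF fun hws => (hsub hws).1.ne (mem_sphere.1 hw)
  have hr' : ∀ w ∈ sphere c r, G w = F w := fun w hw =>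
    hGF fun hws => (hsub hws).2 (sphere_subset_closedBall hw)
  rw [← circleIntegral.integral_congr (hr.le.trans hrR) hR,
    ← circleIntegral.integral_congr hr.le hr']
  refine circleIntegral_eq_of_differentiable_on_annulus_off_countable hr hrR hs.countable
    (fun w hw => ?_) fun w hw => hG w (hclosed hw.1) hw.2
  by_cases hws : w ∈ s
  · exact (hGp w hws).continuousWithinAt
  · exact (hG w hw hws).continuousAt.continuousWithinAt

lemma circleIntegral_sub_inv_of_notMem_closedBall {c p : ℂ} {r : ℝ} (hr : 0 ≤ r)
    (hp : p ∉ closedBall c r) : (∮ w in C(c, r), (w - p)⁻¹) = 0 := by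
  have hd : ∀ w ∈ closedBall c r, DifferentiableAt ℂ (fun w => (w - p)⁻¹) w := fun w hw => by
    simpa using differentiableAt_sub_inv_smul (ne_of_mem_of_not_mem hw hp) (1 : ℂ)
  exact circleIntegral_eq_zero_of_differentiable_on_off_countable hr Set.countable_empty
    (fun w hw => (hd w hw).continuousAt.continuousWithinAt)
    fun w hw => hd w (ball_subset_closedBall hw.1)

lemma circleIntegral_sub_sum_principalParts {c : ℂ} {r : ℝ} (hr : 0 ≤ r)
    (hF : CircleIntegrable F c r) (hp : ∀ i ∈ s, p i ∉ sphere c r) :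
    (∮ w in C(c, r), F w - ∑ i ∈ s, (w - p i)⁻¹ • res i)
      = (∮ w in C(c, r), F w) - ∑ i ∈ s, (∮ w in C(c, r), (w - p i)⁻¹) • res i := by
  have hint : ∀ i ∈ s, CircleIntegrable (fun w => (w - p i)⁻¹ • res i) c r := fun i hi =>
    ContinuousOn.circleIntegrable hr fun w hw =>
      (differentiableAt_sub_inv_smul (ne_of_mem_of_not_mem hw (hp i hi))
        (res i)).continuousAt.continuousWithinAt
  rw [circleIntegral.integral_sub hF (CircleIntegrable.fun_sum s hint),
    circleIntegral.integral_fun_sum hint]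
  simp only [circleIntegral.integral_smul_const]

lemma circleIntegral_sub_sum_principalParts_of_mem_ball {c : ℂ} {r : ℝ} (hr : 0 ≤ r)
    (hF : CircleIntegrable F c r) (hp : ∀ i ∈ s, p i ∈ ball c r) :
    (∮ w in C(c, r), F w - ∑ i ∈ s, (w - p i)⁻¹ • res i)
      = (∮ w in C(c, r), F w) - (2 * Real.pi * I : ℂ) • ∑ i ∈ s, res i := by
  rw [circleIntegral_sub_sum_principalParts hr hF fun i hi h => (hp i hi).ne h, Finset.smul_sum]
  congr 1
  refine Finset.sum_congr rfl fun i hi => ?_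
  rw [circleIntegral.integral_sub_inv_of_mem_ball (hp i hi)]

lemma circleIntegral_sub_sum_principalParts_of_notMem_closedBall {c : ℂ} {r : ℝ} (hr : 0 ≤ r)
    (hF : CircleIntegrable F c r) (hp : ∀ i ∈ s, p i ∉ closedBall c r) :
    (∮ w in C(c, r), F w - ∑ i ∈ s, (w - p i)⁻¹ • res i) = ∮ w in C(c, r), F w := by
  rw [circleIntegral_sub_sum_principalParts hr hF fun i hi h =>
    hp i hi (sphere_subset_closedBall h), sub_eq_self]
  refine Finset.sum_eq_zero fun i hi => ?_
  rw [circleIntegral_sub_inv_of_notMem_closedBall hr (hp i hi), zero_smul]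

theorem circleIntegral_sub_circleIntegral_eq_sum_residues {c : ℂ} {r R : ℝ} (hr : 0 < r)
    (hrR : r ≤ R) (hinj : Set.InjOn p s) (hp : ∀ i ∈ s, p i ∈ ball c R \ closedBall c r)
    (hd : ∀ w ∈ closedBall c R \ ball c r, w ∉ p '' s → DifferentiableAt ℂ F w)
    (hres : ∀ i ∈ s, Tendsto (fun w => (w - p i) • F w) (𝓝[≠] p i) (𝓝 (res i))) :
    (∮ w in C(c, R), F w) - (∮ w in C(c, r), F w) = (2 * Real.pi * I : ℂ) • ∑ i ∈ s, res i := by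
  have hR : 0 ≤ R := hr.le.trans hrR
  have hintR : CircleIntegrable F c R := ContinuousOn.circleIntegrable hR fun w hw =>
    (hd w ⟨sphere_subset_closedBall hw, fun h => hrR.not_gt (hw ▸ h)⟩ <| by
      rintro ⟨i, hi, rfl⟩
      exact (hp i hi).1.ne hw).continuousAt.continuousWithinAt
  have hintr : CircleIntegrable F c r := ContinuousOn.circleIntegrable hr.le fun w hw =>
    (hd w ⟨closedBall_subset_closedBall hrR (sphere_subset_closedBall hw), fun h => h.ne hw⟩ <| by
      rintro ⟨i, hi, rfl⟩
      exact (hp i hi).2 (sphere_subset_closedBall hw)).continuousAt.continuousWithinAt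
  have hregular := circleIntegral_eq_of_removable_singularities hr hrR
    (F := fun w => F w - ∑ i ∈ s, (w - p i)⁻¹ • res i) (s.finite_toSet.image p)
    (Set.image_subset_iff.2 hp)
    (fun w hw hws => (hd w hw hws).sub <| .fun_sum fun i hi =>
      differentiableAt_sub_inv_smul (fun h => hws ⟨i, hi, h.symm⟩) (res i))
    (Set.forall_mem_image.2 fun i hi => tendsto_sub_smul_sub_sum_principalParts hinj hi (hres i hi))
  rw [circleIntegral_sub_sum_principalParts_of_mem_ball hR hintR fun i hi => (hp i hi).1,
    circleIntegral_sub_sum_principalParts_of_notMem_closedBall hr.le hintr fun i hi => (hp i hi).2]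
    at hregular
  rw [← hregular, sub_sub_cancel]

end Residue

section CircleAverage

open Metric Complex Real

variable {E : Type*} [NormedAddCommGroup E] [NormedSpace ℂ E] {F : ℂ → E} {c : ℂ}

lemma norm_circleAverage_le {r M : ℝ} (hF : ∀ w ∈ sphere c |r|, ‖F w‖ ≤ M) :
    ‖circleAverage F c r‖ ≤ M := by
  have hint := intervalIntegral.norm_integral_le_of_norm_le_const (a := 0) (b := 2 * π)
    fun θ _ => hF _ (circleMap_mem_sphere' c r θ)
  rw [sub_zero, abs_of_pos two_pi_pos] at hint
  rw [circleAverage_def, norm_smul, norm_inv, Real.norm_of_nonneg two_pi_pos.le,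
    inv_mul_le_iff₀ two_pi_pos, mul_comm (2 * π)]
  exact hint

lemma integral_circleMap_eq_smul_circleAverage (F : ℂ → E) (c : ℂ) (r : ℝ) :
    ∫ θ in (-π)..π, F (circleMap c r θ) = (2 * π) • circleAverage F c r := by
  rw [circleAverage_eq_integral_add (-π), smul_inv_smul₀ two_pi_pos.ne',
    intervalIntegral.integral_comp_add_right (fun θ => F (circleMap c r θ)),
    zero_add, two_mul, add_neg_cancel_right]

lemma circleAverage_comp_inv (F : ℂ → E) (r : ℝ) :
    circleAverage (fun w => F w⁻¹) 0 r⁻¹ = circleAverage F 0 r := by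
  rw [circleAverage_eq_circleAverage_zero_one, circleAverage_eq_circleAverage_zero_one (f := F),
    ← circleAverage_zero_one_congr_inv (f := fun z => F (r * z + 0))]
  simp [mul_comm]

variable [CompleteSpace E] {κ : Type*} {p : κ → ℂ} {res : κ → E}

theorem circleAverage_sub_circleAverage_eq_sum_residues {s : Finset κ} {r R : ℝ} (hr : 0 < r)
    (hrR : r ≤ R) (hinj : Set.InjOn p s) (hp : ∀ i ∈ s, p i ∈ ball c R \ closedBall c r)
    (hd : ∀ w ∈ closedBall c R \ ball c r, w ∉ p '' s → DifferentiableAt ℂ F w)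
    (hres : ∀ i ∈ s, Tendsto (fun w => (w - p i) • (w - c)⁻¹ • F w) (𝓝[≠] p i) (𝓝 (res i))) :
    circleAverage F c R - circleAverage F c r = ∑ i ∈ s, res i := by
  have hd' : ∀ w ∈ closedBall c R \ ball c r, w ∉ p '' s →
      DifferentiableAt ℂ (fun w => (w - c)⁻¹ • F w) w := fun w hw hws =>
    ((differentiableAt_id.sub_const c).inv (sub_ne_zero.2 fun h =>
      hw.2 (h ▸ mem_ball_self hr))).smul (hd w hw hws)
  rw [circleAverage_eq_circleIntegral (hr.trans_le hrR).ne', circleAverage_eq_circleIntegral hr.ne',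
    ← smul_sub, circleIntegral_sub_circleIntegral_eq_sum_residues hr hrR hinj hp hd' hres,
    inv_smul_smul₀ two_pi_I_ne_zero]

theorem circleAverage_eq_tsum_residues {R : ℝ} (hinj : Function.Injective p)
    (hp : ∀ k, p k ∈ ball c R \ {c}) (hlim : Tendsto p cofinite (𝓝 c))
    (hd : ∀ w ∈ closedBall c R \ {c}, w ∉ Set.range p → DifferentiableAt ℂ F w)
    (hres : ∀ k, Tendsto (fun w => (w - p k) • (w - c)⁻¹ • F w) (𝓝[≠] p k) (𝓝 (res k)))
    (hsum : Summable res) {r : ℕ → ℝ} (hr : ∀ n, r n ∈ Set.Ioc 0 R) (hr0 : Tendsto r atTop (𝓝 0))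
    (hsphere : ∀ n k, p k ∉ sphere c (r n))
    (havg : Tendsto (fun n => circleAverage F c (r n)) atTop (𝓝 0)) :
    circleAverage F c R = ∑' k, res k := by
  have hfin : ∀ n, {k | p k ∉ closedBall c (r n)}.Finite := fun n =>
    hlim (closedBall_mem_nhds c (hr n).1)
  have houter : Tendsto (fun n => (hfin n).toFinset) atTop atTop := by
    refine tendsto_atTop.2 fun t => ?_
    have hsmall : ∀ k ∈ t, ∀ᶠ n in atTop, r n < dist (p k) c := fun k _ =>
      hr0.eventually_lt_const (dist_pos.2 (hp k).2)
    filter_upwards [(Finset.eventually_all t).2 hsmall] with n hn k hk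
    simpa using hn k hk
  have hannulus : ∀ n, circleAverage F c R - circleAverage F c (r n)
      = ∑ k ∈ (hfin n).toFinset, res k := fun n =>
    circleAverage_sub_circleAverage_eq_sum_residues (hr n).1 (hr n).2 hinj.injOn
      (fun k hk => ⟨(hp k).1, (hfin n).mem_toFinset.1 hk⟩)
      (fun w hw hws => by
        refine hd w ⟨hw.1, fun h => hw.2 (h ▸ mem_ball_self (hr n).1)⟩ ?_
        rintro ⟨k, rfl⟩
        have hk : p k ∈ closedBall c (r n) := by simpa using fun h => hws ⟨k, h, rfl⟩
        exact hw.2 (lt_of_le_of_ne hk (hsphere n k)))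
      fun k _ => hres k
  refine tendsto_nhds_unique ?_ (hsum.hasSum.comp houter)
  simpa only [Function.comp_def, ← hannulus, sub_zero] using
    (tendsto_const_nhds (x := circleAverage F c R)).sub havg

end CircleAverage

section Pochhammer

variable {q : ℂ}

lemma summable_norm_mul_pow (hq1 : ‖q‖ < 1) (a : ℂ) : Summable fun n : ℕ => ‖-(a * q ^ n)‖ := by
  simpa [norm_mul] using
    (summable_geometric_of_lt_one (norm_nonneg q) hq1).mul_left ‖a‖

lemma multipliable_one_sub_mul_pow (hq1 : ‖q‖ < 1) (a : ℂ) :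
    Multipliable fun n : ℕ => 1 - a * q ^ n := by
  simpa [sub_eq_add_neg] using multipliable_one_add_of_summable (summable_norm_mul_pow hq1 a)

lemma tendsto_poch (hq1 : ‖q‖ < 1) (a : ℂ) :
    Tendsto (poch a q) atTop (𝓝 (pochInf a q)) :=
  (multipliable_one_sub_mul_pow hq1 a).hasProd.tendsto_prod_nat

lemma pochInf_eq_poch_mul (hq1 : ‖q‖ < 1) (a : ℂ) (n : ℕ) :
    pochInf a q = poch a q n * pochInf (a * q ^ n) q := by
  have htail : Multipliable fun k : ℕ => 1 - a * q ^ (k + n) := by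
    simpa [pow_add, mul_assoc, mul_comm, mul_left_comm] using
      multipliable_one_sub_mul_pow hq1 (a * q ^ n)
  unfold pochInf poch
  rw [← Multipliable.prod_mul_tprod_nat_mul' (f := fun k : ℕ => 1 - a * q ^ k) (k := n) htail]
  congr 1
  refine tprod_congr fun k => ?_
  ring

lemma poch_succ (a q : ℂ) (n : ℕ) : poch a q (n + 1) = poch a q n * (1 - a * q ^ n) := by
  simp [poch, Finset.prod_range_succ]

lemma poch_succ' (a q : ℂ) (n : ℕ) : poch a q (n + 1) = (1 - a) * poch (a * q) q n := by
  simp only [poch, Finset.prod_range_succ']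
  rw [mul_comm]
  congr 1
  · simp
  · refine Finset.prod_congr rfl fun k _ => ?_
    ring

lemma pochInf_eq_one_sub_mul (hq1 : ‖q‖ < 1) (a : ℂ) :
    pochInf a q = (1 - a) * pochInf (a * q) q := by
  simpa [poch] using pochInf_eq_poch_mul hq1 a 1

lemma one_sub_mul_pow_ne_zero {a : ℂ} (ha : a ∉ Omega q) (n : ℕ) :
    1 - a * q ^ n ≠ 0 := fun h =>
  ha ⟨n, eq_inv_of_mul_eq_one_left (sub_eq_zero.1 h).symm⟩

lemma pochInf_ne_zero (hq1 : ‖q‖ < 1) {a : ℂ} (ha : a ∉ Omega q) :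
    pochInf a q ≠ 0 := by
  unfold pochInf
  simp only [sub_eq_add_neg]
  refine tprod_one_add_ne_zero_of_summable (fun n => ?_) (summable_norm_mul_pow hq1 a)
  simpa [sub_eq_add_neg] using one_sub_mul_pow_ne_zero ha n

lemma poch_ne_zero {a : ℂ} (ha : a ∉ Omega q) (n : ℕ) : poch a q n ≠ 0 :=
  Finset.prod_ne_zero_iff.2 fun k _ => one_sub_mul_pow_ne_zero ha k

lemma notMem_Omega_of_norm_lt_one (hq0 : q ≠ 0) (hq1 : ‖q‖ < 1) {a : ℂ} (ha : ‖a‖ < 1) :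
    a ∉ Omega q := by
  rintro ⟨k, rfl⟩
  rw [norm_inv, norm_pow] at ha
  exact absurd ha (not_lt.2 (one_le_inv_iff₀.2
    ⟨pow_pos (norm_pos_iff.2 hq0) k, pow_le_one₀ (norm_nonneg q) hq1.le⟩))

lemma q_mul_notMem_Omega (hq0 : q ≠ 0) {a : ℂ} (ha : a ∉ Omega q) : q * a ∉ Omega q := by
  rintro ⟨k, hk⟩
  refine ha ⟨k + 1, ?_⟩
  rw [pow_succ, mul_inv, ← hk]
  field_simp

lemma differentiable_pochInf (hq1 : ‖q‖ < 1) : Differentiable ℂ fun a => pochInf a q := by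
  have hball : ∀ R : ℝ, DifferentiableOn ℂ (fun a => pochInf a q) (Metric.ball 0 R) := by
    intro R
    have hprod := Summable.hasProdLocallyUniformlyOn_nat_one_add (K := Metric.ball (0 : ℂ) R)
      (f := fun (n : ℕ) (a : ℂ) => -(a * q ^ n)) Metric.isOpen_ball
      (u := fun n => R * ‖q‖ ^ n)
      ((summable_geometric_of_lt_one (norm_nonneg q) hq1).mul_left R)
      (Eventually.of_forall fun n x hx => by
        rw [norm_neg, norm_mul, norm_pow]
        exact mul_le_mul_of_nonneg_right (mem_ball_zero_iff.1 hx).le (by positivity))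
      (fun n => by fun_prop)
    have hdiff := hprod.tendstoLocallyUniformlyOn_finsetRange.differentiableOn
      (Eventually.of_forall fun n => by fun_prop) Metric.isOpen_ball
    simpa [pochInf, sub_eq_add_neg] using hdiff
  intro a
  exact (hball (‖a‖ + 1)).differentiableAt (Metric.isOpen_ball.mem_nhds (by simp))

lemma poch_mul_inv_pow (hq0 : q ≠ 0) {y : ℂ} (hy : y ≠ 0) (n : ℕ) :
    poch (y * (q ^ n)⁻¹) q n
      = poch (q / y) q n * (y ^ n * ((-1) ^ n * q ^ n.choose 2)⁻¹ * (q ^ n)⁻¹) := by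
  induction n with
  | zero => simp [poch]
  | succ n ih =>
    have hshift : y * (q ^ (n + 1))⁻¹ * q = y * (q ^ n)⁻¹ := by
      rw [pow_succ]; field_simp
    rw [poch_succ', hshift, ih, poch_succ, Nat.choose_succ_succ' n 1, Nat.choose_one_right]
    have hsign : (-1 : ℂ) ^ n ≠ 0 := pow_ne_zero _ (by norm_num)
    simp only [pow_succ, pow_add]
    field_simp
    ring

lemma pochInf_mul_inv_pow (hq0 : q ≠ 0) (hq1 : ‖q‖ < 1) {y : ℂ} (hy : y ≠ 0) (n : ℕ) :
    pochInf (y * (q ^ n)⁻¹) q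
      = pochInf y q * (poch (q / y) q n * (y ^ n * ((-1) ^ n * q ^ n.choose 2)⁻¹ * (q ^ n)⁻¹)) := by
  rw [pochInf_eq_poch_mul hq1 _ n, poch_mul_inv_pow hq0 hy, mul_assoc y,
    inv_mul_cancel₀ (pow_ne_zero n hq0), mul_one, mul_comm]

lemma theta_mul_q_mul (hq0 : q ≠ 0) (hq1 : ‖q‖ < 1) {x : ℂ} (hx : x ≠ 0) :
    theta (x * q) q * x = -theta x q := by
  unfold theta
  have hqxq : q / (x * q) = x⁻¹ := by field_simp
  have hqx : q / x = x⁻¹ * q := by field_simp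
  rw [hqxq, hqx, pochInf_eq_one_sub_mul hq1 x, pochInf_eq_one_sub_mul hq1 x⁻¹]
  field_simp
  ring

lemma theta_mul_pow (hq0 : q ≠ 0) (hq1 : ‖q‖ < 1) {x : ℂ} (hx : x ≠ 0) (n : ℕ) :
    theta (x * q ^ n) q = theta x q * ((-1) ^ n * (q ^ n.choose 2)⁻¹ * (x ^ n)⁻¹) := by
  induction n with
  | zero => simp
  | succ n ih =>
    have hne := mul_ne_zero hx (pow_ne_zero n hq0)
    have hshift := theta_mul_q_mul hq0 hq1 hne
    rw [ih, mul_assoc x, ← pow_succ] at hshift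
    rw [← mul_left_inj' hne, hshift, Nat.choose_succ_succ' n 1, Nat.choose_one_right]
    simp only [pow_succ, pow_add]
    field_simp

lemma theta_mul_pow_mul_theta_mul_inv_pow (hq0 : q ≠ 0) (hq1 : ‖q‖ < 1) {x y : ℂ}
    (hx : x ≠ 0) (hy : y ≠ 0) (n : ℕ) :
    theta (x * q ^ n) q * theta (y * (q ^ n)⁻¹) q
      = theta x q * theta y q
        * ((y / x) ^ n * (((-1) ^ n * q ^ n.choose 2) ^ 2 * q ^ n)⁻¹) := by
  have hqn := pow_ne_zero n hq0
  have hsign : (-1 : ℂ) ^ n ≠ 0 := pow_ne_zero _ (by norm_num)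
  have hback := theta_mul_pow hq0 hq1 (mul_ne_zero hy (inv_ne_zero hqn)) n
  rw [inv_mul_cancel_right₀ hqn] at hback
  have hsq : (q ^ n) ^ n = ((-1) ^ n * q ^ n.choose 2) ^ 2 * q ^ n := by
    rw [mul_pow, pow_right_comm (-1) n 2, neg_one_sq, one_pow, one_mul, ← pow_mul,
      ← pow_mul, ← pow_add, Nat.choose_two_right,
      Nat.div_mul_cancel (Nat.even_mul_pred_self n).two_dvd]
    congr 1
    cases n with
    | zero => rfl
    | succ n => simp; ring
  rw [theta_mul_pow hq0 hq1 hx, hback, ← hsq, mul_pow, inv_pow, div_pow]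
  field_simp

end Pochhammer

section GeometricPoles

open Metric Real

variable {q : ℂ} {ι : Type*} {e : ι → ℂ}

lemma norm_mul_pow_le (hq1 : ‖q‖ < 1) (w : ℂ) (n : ℕ) : ‖w * q ^ n‖ ≤ ‖w‖ := by
  rw [norm_mul, norm_pow]
  exact mul_le_of_le_one_right (norm_nonneg w) (pow_le_one₀ (norm_nonneg q) hq1.le)

lemma pow_right_injective_of_norm_lt_one (hq0 : q ≠ 0) (hq1 : ‖q‖ < 1) :
    Function.Injective fun n : ℕ => q ^ n := by
  intro n k h
  exact (pow_right_strictAnti₀ (norm_pos_iff.2 hq0) hq1).injective (by simpa using congrArg norm h)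

lemma mul_pow_injective (hq0 : q ≠ 0) (hq1 : ‖q‖ < 1) (he0 : ∀ i, e i ≠ 0)
    (hne : ∀ i j, i ≠ j → e i / e j ∉ Omega q) :
    Function.Injective fun x : ι × ℕ => e x.1 * q ^ x.2 := by
  have index_eq_of_le : ∀ i j : ι, ∀ n k : ℕ, n ≤ k → e i * q ^ n = e j * q ^ k → i = j := by
    intro i j n k hnk h
    by_contra hij
    obtain ⟨l, rfl⟩ := Nat.exists_eq_add_of_le hnk
    have hqn := pow_ne_zero n hq0
    have hql := pow_ne_zero l hq0
    refine hne j i (Ne.symm hij) ⟨l, ?_⟩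
    rw [div_eq_iff (he0 i), eq_comm, inv_mul_eq_iff_eq_mul₀ hql]
    rw [pow_add] at h
    apply mul_right_cancel₀ hqn
    linear_combination h
  rintro ⟨i, n⟩ ⟨j, k⟩ h
  obtain rfl : i = j := by
    rcases le_total n k with hnk | hnk
    · exact index_eq_of_le i j n k hnk h
    · exact (index_eq_of_le j i k n hnk h.symm).symm
  exact Prod.ext rfl (pow_right_injective_of_norm_lt_one hq0 hq1 (mul_left_cancel₀ (he0 i) h))

lemma exists_radius_avoiding {κ : Type*} [Countable κ] (p : κ → ℂ) {t ρ₀ : ℝ} (ht : 0 < t)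
    (hρ₀ : 0 < ρ₀) : ∃ ρ ∈ Set.Ioo 0 ρ₀, ∀ (n : ℕ) k, p k ∉ sphere (0 : ℂ) (ρ * t ^ n) := by
  have hcount : (Set.range fun x : κ × ℕ => ‖p x.1‖ / t ^ x.2).Countable := Set.countable_range _
  obtain ⟨ρ, hρ, hρpos, hρlt⟩ := (hcount.dense_compl ℝ).exists_between hρ₀
  refine ⟨ρ, ⟨hρpos, hρlt⟩, fun n k h => hρ ⟨(k, n), ?_⟩⟩
  simp only [mem_sphere_zero_iff_norm.1 h]
  exact mul_div_cancel_right₀ _ (pow_pos ht n).ne'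

variable {E : Type*} [NormedAddCommGroup E]

lemma summable_prod_of_finite {β : Type*} [Finite ι] {g : ι × β → E}
    (hg : ∀ i, Summable fun b => g (i, b)) : Summable g := by
  classical
  cases nonempty_fintype ι
  have hrow : ∀ i, Summable fun x : ι × β => if x.1 = i then g x else 0 := fun i => by
    refine ((Prod.mk_right_injective i).summable_iff ?_).1 (by simpa [Function.comp_def] using hg i)
    rintro ⟨j, b⟩ hx
    exact if_neg fun h => hx ⟨b, by simpa using h.symm⟩
  exact (summable_sum fun i (_ : i ∈ Finset.univ) => hrow i).congr fun x => by simp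

variable [NormedSpace ℂ E] {F : ℂ → E}

lemma tendsto_circleAverage_mul_pow (hq0 : q ≠ 0) (hq1 : ‖q‖ < 1) {L ρ : ℝ} (hL0 : 0 ≤ L)
    (hL1 : L < 1) (hρ : 0 < ρ) (hF : ContinuousOn F (sphere 0 ρ))
    (hdecay : ∀ w ∈ closedBall 0 ρ \ {0}, ‖F (w * q)‖ ≤ L * ‖F w‖) :
    Tendsto (fun n : ℕ => circleAverage F 0 (ρ * ‖q‖ ^ n)) atTop (𝓝 0) := by
  obtain ⟨M, hM⟩ := (isCompact_sphere (0 : ℂ) ρ).exists_bound_of_continuousOn hF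
  have hiter : ∀ w ∈ sphere (0 : ℂ) ρ, ∀ n : ℕ, ‖F (w * q ^ n)‖ ≤ L ^ n * M := by
    intro w hw n
    have hw' : ‖w‖ = ρ := mem_sphere_zero_iff_norm.1 hw
    induction n with
    | zero => simpa using hM w hw
    | succ n ih =>
      have hmem : w * q ^ n ∈ closedBall (0 : ℂ) ρ \ {0} := by
        refine ⟨?_, mul_ne_zero (norm_pos_iff.1 (hw' ▸ hρ)) (pow_ne_zero n hq0)⟩
        exact mem_closedBall_zero_iff.2 ((norm_mul_pow_le hq1 w n).trans hw'.le)
      calc ‖F (w * q ^ (n + 1))‖ = ‖F (w * q ^ n * q)‖ := by rw [pow_succ, mul_assoc]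
        _ ≤ L * ‖F (w * q ^ n)‖ := hdecay _ hmem
        _ ≤ L * (L ^ n * M) := mul_le_mul_of_nonneg_left ih hL0
        _ = L ^ (n + 1) * M := by rw [pow_succ', mul_assoc]
  refine squeeze_zero_norm (a := fun n => L ^ n * M) (fun n => norm_circleAverage_le fun w hw => ?_)
    (by simpa using (tendsto_pow_atTop_nhds_zero_of_lt_one hL0 hL1).mul_const M)
  have hqn := pow_ne_zero n hq0
  have hw' : w / q ^ n ∈ sphere (0 : ℂ) ρ := by
    rw [mem_sphere_zero_iff_norm, abs_of_nonneg (by positivity)] at hw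
    rw [mem_sphere_zero_iff_norm, norm_div, hw, norm_pow,
      mul_div_cancel_right₀ _ (pow_ne_zero n (norm_ne_zero_iff.2 hq0))]
  simpa [div_mul_cancel₀ w hqn] using hiter _ hw' n

theorem circleAverage_eq_sum_tsum_residues [CompleteSpace E] [Fintype ι] (hq0 : q ≠ 0)
    (hq1 : ‖q‖ < 1) (he0 : ∀ i, e i ≠ 0) (hne : ∀ i j, i ≠ j → e i / e j ∉ Omega q) {ρ : ℝ}
    (hρ : 0 < ρ) (heρ : ∀ i, ‖e i‖ < ρ)
    (hd : ∀ w ∈ closedBall 0 ρ \ {0}, (∀ i (n : ℕ), w ≠ e i * q ^ n) → DifferentiableAt ℂ F w)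
    {L : ℝ} (hL0 : 0 ≤ L) (hL1 : L < 1) (hdecay : ∀ᶠ w in 𝓝[≠] 0, ‖F (w * q)‖ ≤ L * ‖F w‖)
    {res : ι → ℕ → E}
    (hres : ∀ i n, Tendsto (fun w => (w - e i * q ^ n) • w⁻¹ • F w) (𝓝[≠] (e i * q ^ n))
      (𝓝 (res i n)))
    (hsum : ∀ i, Summable (res i)) : circleAverage F 0 ρ = ∑ i, ∑' n, res i n := by
  obtain ⟨δ, hδ, hdecay⟩ := (nhdsWithin_hasBasis nhds_basis_closedBall _).eventually_iff.1 hdecay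
  have hqpos : 0 < ‖q‖ := norm_pos_iff.2 hq0
  set p : ι × ℕ → ℂ := fun x => e x.1 * q ^ x.2
  obtain ⟨r, ⟨hr, hrlt⟩, hsphere⟩ := exists_radius_avoiding p hqpos (lt_min hρ hδ)
  obtain ⟨hrρ, hrδ⟩ := lt_min_iff.1 hrlt
  have hp0 : Tendsto p cofinite (𝓝 0) := Summable.tendsto_cofinite_zero <|
    summable_prod_of_finite fun i => (summable_geometric_of_norm_lt_one hq1).mul_left (e i)
  have hpρ : ∀ x, p x ∈ ball 0 ρ \ {0} := fun x =>
    ⟨mem_ball_zero_iff.2 ((norm_mul_pow_le hq1 _ _).trans_lt (heρ x.1)),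
      mul_ne_zero (he0 x.1) (pow_ne_zero x.2 hq0)⟩
  have hcont : ContinuousOn F (sphere 0 r) := fun w hw => by
    have hwr := mem_sphere_zero_iff_norm.1 hw
    refine (hd w ⟨?_, norm_pos_iff.1 (hwr ▸ hr)⟩ fun i n h => ?_).continuousAt.continuousWithinAt
    · simpa [hwr] using hrρ.le
    · exact hsphere 0 (i, n) (by simpa [p, ← h] using hwr)
  have hsum' : Summable fun x : ι × ℕ => res x.1 x.2 := summable_prod_of_finite hsum
  have havg := tendsto_circleAverage_mul_pow hq0 hq1 hL0 hL1 hr hcont fun w hw =>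
    hdecay ⟨closedBall_subset_closedBall hrδ.le hw.1, hw.2⟩
  rw [circleAverage_eq_tsum_residues (mul_pow_injective hq0 hq1 he0 hne) hpρ hp0
    (fun w hw h => hd w hw fun i n hw' => h ⟨(i, n), hw'.symm⟩)
    (fun x => by simpa only [sub_zero] using hres x.1 x.2) hsum'
    (fun n => ⟨by positivity, (mul_le_of_le_one_right hr.le
      (pow_le_one₀ (norm_nonneg q) hq1.le)).trans hrρ.le⟩)
    (by simpa using (tendsto_pow_atTop_nhds_zero_of_lt_one (norm_nonneg q) hq1).const_mul r)
    hsphere havg, hsum'.tsum_prod, tsum_fintype]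

end GeometricPoles

section Kernel

variable {q : ℂ}

lemma pochInfM_add (S T : Multiset ℂ) (q : ℂ) :
    pochInfM (S + T) q = pochInfM S q * pochInfM T q := by
  simp [pochInfM]

lemma smulM_add (b : ℂ) (S T : Multiset ℂ) : smulM b (S + T) = smulM b S + smulM b T := by
  simp [smulM]

lemma pochInfM_smulM (b : ℂ) (S : Multiset ℂ) (q : ℂ) :
    pochInfM (smulM b S) q = (S.map fun x => pochInf (b * x) q).prod := by
  simp [pochInfM, smulM, Multiset.map_map]

lemma pochInfM_smulM_cons (b x : ℂ) (S : Multiset ℂ) (q : ℂ) :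
    pochInfM (smulM b (x ::ₘ S)) q = pochInf (b * x) q * pochInfM (smulM b S) q := by
  simp [pochInfM_smulM]

lemma prod_map_ne_zero {ι M : Type*} [CommMonoidWithZero M] [NoZeroDivisors M] [Nontrivial M]
    {S : Multiset ι} {g : ι → M} (h : ∀ x ∈ S, g x ≠ 0) : (S.map g).prod ≠ 0 :=
  Multiset.prod_ne_zero (by simpa using h)

lemma pochInfM_ne_zero (hq1 : ‖q‖ < 1) {S : Multiset ℂ} (hS : ∀ x ∈ S, x ∉ Omega q) :
    pochInfM S q ≠ 0 :=
  prod_map_ne_zero fun x hx => pochInf_ne_zero hq1 (hS x hx)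

lemma differentiable_pochInfM_smulM (hq1 : ‖q‖ < 1) (S : Multiset ℂ) :
    Differentiable ℂ fun w => pochInfM (smulM w S) q := by
  induction S using Multiset.induction_on with
  | empty => simp [pochInfM_smulM]
  | cons x S ih =>
    simp only [pochInfM_smulM_cons]
    exact ((differentiable_pochInf hq1).comp (differentiable_id.mul_const x)).mul ih

lemma pochInfM_smulM_eq_prod_mul (hq1 : ‖q‖ < 1) (w : ℂ) (S : Multiset ℂ) :
    pochInfM (smulM w S) q
      = (S.map fun x => 1 - w * x).prod * pochInfM (smulM (w * q) S) q := by
  simp only [pochInfM_smulM]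
  rw [← Multiset.prod_map_mul]
  refine congrArg Multiset.prod (Multiset.map_congr rfl fun x _ => ?_)
  rw [pochInf_eq_one_sub_mul hq1, mul_right_comm]

lemma inv_mul_mem_Omega_iff (hq0 : q ≠ 0) {w x : ℂ} (hw : w ≠ 0) :
    w⁻¹ * x ∈ Omega q ↔ ∃ n : ℕ, w = x * q ^ n := by
  refine exists_congr fun n => ?_
  rw [inv_mul_eq_iff_eq_mul₀ hw, eq_mul_inv_iff_mul_eq₀ (pow_ne_zero n hq0), eq_comm]

/-- The function `(P w, Q / w; q)_∞ / (R w, S / w; q)_∞`; the integrand is of this form both in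
`w = z / σ` and in `w = σ / z`. -/
def kernel (P Q R S : Multiset ℂ) (q w : ℂ) : ℂ :=
  pochInfM (smulM w P) q * pochInfM (smulM w⁻¹ Q) q
    / (pochInfM (smulM w R) q * pochInfM (smulM w⁻¹ S) q)

lemma kernel_inv (P Q R S : Multiset ℂ) (q w : ℂ) :
    kernel P Q R S q w⁻¹ = kernel Q P S R q w := by
  simp only [kernel, inv_inv]
  ring

lemma kernel_cons (P Q R S : Multiset ℂ) (q w x : ℂ) :
    kernel P Q R (x ::ₘ S) q w = (pochInf (w⁻¹ * x) q)⁻¹ * kernel P Q R S q w := by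
  simp only [kernel, pochInfM_smulM_cons, div_eq_mul_inv, mul_inv]
  ring

lemma differentiableAt_kernel (hq1 : ‖q‖ < 1) (P Q : Multiset ℂ) {R S : Multiset ℂ} {w : ℂ}
    (hw : w ≠ 0) (hR : ∀ x ∈ R, w * x ∉ Omega q) (hS : ∀ x ∈ S, w⁻¹ * x ∉ Omega q) :
    DifferentiableAt ℂ (kernel P Q R S q) w := by
  have hinv (T : Multiset ℂ) : DifferentiableAt ℂ (fun w => pochInfM (smulM w⁻¹ T) q) w :=
    (differentiable_pochInfM_smulM hq1 T _).comp w (differentiableAt_inv hw)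
  refine ((differentiable_pochInfM_smulM hq1 P w).mul (hinv Q)).div
    ((differentiable_pochInfM_smulM hq1 R w).mul (hinv S))
    (mul_ne_zero (pochInfM_ne_zero hq1 ?_) (pochInfM_ne_zero hq1 ?_))
  · simpa [smulM] using hR
  · simpa [smulM] using hS

lemma poch_inv_pow_ne_zero (hq0 : q ≠ 0) (hq1 : ‖q‖ < 1) (n : ℕ) : poch (q ^ n)⁻¹ q n ≠ 0 := by
  refine Finset.prod_ne_zero_iff.2 fun k hk h => ?_
  rw [sub_eq_zero, eq_comm, inv_mul_eq_iff_eq_mul₀ (pow_ne_zero n hq0), mul_one] at h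
  exact (Finset.mem_range.1 hk).ne (pow_right_injective_of_norm_lt_one hq0 hq1 h)

lemma pochInf_self_ne_zero (hq0 : q ≠ 0) (hq1 : ‖q‖ < 1) : pochInf q q ≠ 0 :=
  pochInf_ne_zero hq1 (notMem_Omega_of_norm_lt_one hq0 hq1 hq1)

lemma tendsto_sub_mul_inv_pochInf (hq0 : q ≠ 0) (hq1 : ‖q‖ < 1) {x : ℂ} (hx : x ≠ 0) (n : ℕ) :
    Tendsto (fun w => (w - x * q ^ n) * w⁻¹ * (pochInf (w⁻¹ * x) q)⁻¹) (𝓝[≠] (x * q ^ n))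
      (𝓝 (poch (q ^ n)⁻¹ q n * pochInf q q)⁻¹) := by
  have hqn := pow_ne_zero n hq0
  set p := x * q ^ n with hp
  have hp0 : p ≠ 0 := mul_ne_zero hx hqn
  have hpx : p⁻¹ * x = (q ^ n)⁻¹ := by rw [hp]; field_simp
  have hpq : p⁻¹ * x * q ^ (n + 1) = q := by rw [hpx, pow_succ, inv_mul_cancel_left₀ hqn]
  have hpoch : ContinuousAt (fun w => poch (w⁻¹ * x) q n) p := by
    unfold poch
    fun_prop (disch := assumption)
  have hpochInf : ContinuousAt (fun w => pochInf (w⁻¹ * x * q ^ (n + 1)) q) p :=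
    ContinuousAt.comp (g := fun a => pochInf a q)
      (differentiable_pochInf hq1).continuous.continuousAt (by fun_prop (disch := assumption))
  have hne0 : poch (p⁻¹ * x) q n * pochInf (p⁻¹ * x * q ^ (n + 1)) q ≠ 0 := by
    rw [hpq, hpx]
    exact mul_ne_zero (poch_inv_pow_ne_zero hq0 hq1 n) (pochInf_self_ne_zero hq0 hq1)
  have hlim := (hpoch.fun_mul hpochInf).fun_inv₀ hne0
  rw [ContinuousAt, hpq, hpx] at hlim
  refine (hlim.mono_left nhdsWithin_le_nhds).congr' ?_
  filter_upwards [nhdsWithin_le_nhds (eventually_ne_nhds hp0), self_mem_nhdsWithin] with w hw hwp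
  have hfactor : 1 - w⁻¹ * x * q ^ n = (w - p) * w⁻¹ := by rw [hp]; field_simp
  have hne : (w - p) * w⁻¹ ≠ 0 := mul_ne_zero (sub_ne_zero.2 hwp) (inv_ne_zero hw)
  rw [pochInf_eq_poch_mul hq1 (w⁻¹ * x) (n + 1), poch_succ, hfactor, mul_right_comm (poch _ q n),
    mul_inv _ ((w - p) * w⁻¹), mul_left_comm, mul_inv_cancel₀ hne, mul_one]

lemma tendsto_sub_smul_inv_smul_kernel_cons (hq0 : q ≠ 0) (hq1 : ‖q‖ < 1) (P Q : Multiset ℂ)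
    {R S : Multiset ℂ} {x : ℂ} (hx : x ≠ 0) (n : ℕ) (hR : ∀ y ∈ R, x * q ^ n * y ∉ Omega q)
    (hS : ∀ y ∈ S, (x * q ^ n)⁻¹ * y ∉ Omega q) :
    Tendsto (fun w => (w - x * q ^ n) • w⁻¹ • kernel P Q R (x ::ₘ S) q w) (𝓝[≠] (x * q ^ n))
      (𝓝 ((poch (q ^ n)⁻¹ q n * pochInf q q)⁻¹ * kernel P Q R S q (x * q ^ n))) := by
  have hcont := differentiableAt_kernel hq1 P Q (mul_ne_zero hx (pow_ne_zero n hq0)) hR hS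
  refine ((tendsto_sub_mul_inv_pochInf hq0 hq1 hx n).mul
    (hcont.continuousAt.tendsto.mono_left nhdsWithin_le_nhds)).congr fun w => ?_
  simp only [kernel_cons, smul_eq_mul]
  ring

lemma kernel_mul_q (hq0 : q ≠ 0) (hq1 : ‖q‖ < 1) (P Q R S : Multiset ℂ) {w : ℂ}
    (hP : ∀ x ∈ P, 1 - w * x ≠ 0) (hR : ∀ x ∈ R, 1 - w * x ≠ 0) :
    kernel P Q R S q (w * q)
      = ((R.map fun x => 1 - w * x).prod / (P.map fun x => 1 - w * x).prod
        * ((Q.map fun x => 1 - (w * q)⁻¹ * x).prod / (S.map fun x => 1 - (w * q)⁻¹ * x).prod))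
        * kernel P Q R S q w := by
  have hinv : (w * q)⁻¹ * q = w⁻¹ := by
    rw [mul_inv, mul_assoc, inv_mul_cancel₀ hq0, mul_one]
  have hP' := prod_map_ne_zero hP
  have hR' := prod_map_ne_zero hR
  unfold kernel
  rw [pochInfM_smulM_eq_prod_mul hq1 w P, pochInfM_smulM_eq_prod_mul hq1 w R,
    pochInfM_smulM_eq_prod_mul hq1 (w * q)⁻¹ Q, pochInfM_smulM_eq_prod_mul hq1 (w * q)⁻¹ S, hinv]
  simp only [div_eq_mul_inv, mul_inv]
  field_simp

lemma tendsto_prod_one_sub_mul (S : Multiset ℂ) :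
    Tendsto (fun w : ℂ => (S.map fun x => 1 - w * x).prod) (𝓝 0) (𝓝 1) := by
  have hprod := tendsto_multiset_prod (x := 𝓝 (0 : ℂ)) S (f := fun x w => 1 - w * x)
    (a := fun x => 1 - 0 * x) fun x _ => Continuous.tendsto (by fun_prop) 0
  simpa using hprod

lemma tendsto_prod_sub (S : Multiset ℂ) :
    Tendsto (fun w : ℂ => (S.map fun x => w - x).prod) (𝓝 0) (𝓝 (S.map Neg.neg).prod) := by
  simpa using tendsto_multiset_prod (x := 𝓝 (0 : ℂ)) S (f := fun x w => w - x)
    (a := fun x => 0 - x) fun x _ => Continuous.tendsto (by fun_prop) 0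

lemma prod_one_sub_inv_mul (S : Multiset ℂ) {w : ℂ} (hw : w ≠ 0) :
    (S.map fun x => 1 - w⁻¹ * x).prod * w ^ Multiset.card S = (S.map fun x => w - x).prod := by
  have hpow : w ^ Multiset.card S = (S.map fun _ => w).prod := by
    rw [Multiset.map_const', Multiset.prod_replicate]
  rw [hpow, ← Multiset.prod_map_mul]
  refine congrArg Multiset.prod (Multiset.map_congr rfl fun x _ => ?_)
  field_simp

lemma tendsto_prod_div_prod {Q S : Multiset ℂ} (hcard : Multiset.card Q ≤ Multiset.card S)
    (hS : ∀ x ∈ S, x ≠ 0) :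
    Tendsto (fun w : ℂ => (Q.map fun x => 1 - w⁻¹ * x).prod / (S.map fun x => 1 - w⁻¹ * x).prod)
      (𝓝[≠] 0) (𝓝 (0 ^ (Multiset.card S - Multiset.card Q)
        * ((Q.map Neg.neg).prod / (S.map Neg.neg).prod))) := by
  have hS' : (S.map Neg.neg).prod ≠ 0 := prod_map_ne_zero fun x hx => neg_ne_zero.2 (hS x hx)
  have hlim : Tendsto (fun w : ℂ => w ^ (Multiset.card S - Multiset.card Q)
      * ((Q.map fun x => w - x).prod / (S.map fun x => w - x).prod)) (𝓝 0) (𝓝 _) :=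
    ((continuous_pow _).tendsto 0).mul ((tendsto_prod_sub Q).div (tendsto_prod_sub S) hS')
  refine (hlim.mono_left nhdsWithin_le_nhds).congr' ?_
  filter_upwards [self_mem_nhdsWithin] with w hw
  have hw0 : w ≠ 0 := hw
  rw [← prod_one_sub_inv_mul Q hw0, ← prod_one_sub_inv_mul S hw0]
  obtain ⟨k, hk⟩ := Nat.exists_eq_add_of_le hcard
  rw [hk, Nat.add_sub_cancel_left, pow_add]
  field_simp

lemma norm_zero_pow_sub_mul_div_lt_one {Q S : Multiset ℂ}
    (hcard : Multiset.card Q ≤ Multiset.card S)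
    (hprod : Multiset.card Q = Multiset.card S → ‖Q.prod‖ < ‖S.prod‖) :
    ‖0 ^ (Multiset.card S - Multiset.card Q) * ((Q.map Neg.neg).prod / (S.map Neg.neg).prod)‖
      < 1 := by
  rcases hcard.eq_or_lt with h | h
  · rw [h, Nat.sub_self, pow_zero, one_mul, Multiset.prod_map_neg, Multiset.prod_map_neg, h,
      mul_div_mul_left _ _ (pow_ne_zero _ (neg_ne_zero.2 one_ne_zero)), norm_div,
      div_lt_one ((norm_nonneg _).trans_lt (hprod h))]
    exact hprod h
  · rw [zero_pow (Nat.sub_pos_of_lt h).ne', zero_mul, norm_zero]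
    exact one_pos

lemma exists_eventually_norm_kernel_mul_q_le (hq0 : q ≠ 0) (hq1 : ‖q‖ < 1) (P R : Multiset ℂ)
    {Q S : Multiset ℂ} (hcard : Multiset.card Q ≤ Multiset.card S) (hS : ∀ x ∈ S, x ≠ 0)
    (hprod : Multiset.card Q = Multiset.card S → ‖Q.prod‖ < ‖S.prod‖) :
    ∃ L : ℝ, 0 ≤ L ∧ L < 1 ∧ ∀ᶠ w in 𝓝[≠] (0 : ℂ),
      ‖kernel P Q R S q (w * q)‖ ≤ L * ‖kernel P Q R S q w‖ := by
  obtain ⟨L, hlimL, hL1⟩ := exists_between (norm_zero_pow_sub_mul_div_lt_one hcard hprod)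
  refine ⟨L, (norm_nonneg _).trans hlimL.le, hL1, ?_⟩
  have hmulq : Tendsto (fun w : ℂ => w * q) (𝓝[≠] 0) (𝓝[≠] 0) := by
    refine tendsto_nhdsWithin_iff.2 ⟨?_, eventually_nhdsWithin_of_forall fun w hw =>
      mul_ne_zero hw hq0⟩
    simpa using (tendsto_id.mul_const q).mono_left (nhdsWithin_le_nhds (a := (0 : ℂ)))
  have hRP : Tendsto (fun w : ℂ => (R.map fun x => 1 - w * x).prod
      / (P.map fun x => 1 - w * x).prod) (𝓝[≠] 0) (𝓝 (1 / 1)) :=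
    ((tendsto_prod_one_sub_mul R).div (tendsto_prod_one_sub_mul P) one_ne_zero).mono_left
      nhdsWithin_le_nhds
  have hratio := (hRP.mul ((tendsto_prod_div_prod hcard hS).comp hmulq)).norm
  rw [div_one, one_mul] at hratio
  have hne (T : Multiset ℂ) : ∀ᶠ w in 𝓝[≠] (0 : ℂ), ∀ x ∈ T, 1 - w * x ≠ 0 := by
    have hT := (tendsto_prod_one_sub_mul T).eventually_ne one_ne_zero
    filter_upwards [nhdsWithin_le_nhds hT] with w hw x hx h0
    exact hw (Multiset.prod_eq_zero (Multiset.mem_map.2 ⟨x, hx, h0⟩))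
  filter_upwards [hratio.eventually_le_const hlimL, hne P, hne R] with w hw hP hR
  rw [kernel_mul_q hq0 hq1 P Q R S hP hR, norm_mul]
  exact mul_le_mul_of_nonneg_right hw (norm_nonneg _)

lemma mem_params {m : ℕ} {e : Fin m → ℂ} {x : ℂ} : x ∈ params e ↔ ∃ j, e j = x := by
  simp [params]

lemma card_params {m : ℕ} (e : Fin m → ℂ) : Multiset.card (params e) = m := by
  simp [params]

lemma prod_params {m : ℕ} (e : Fin m → ℂ) : (params e).prod = ∏ j, e j := rfl

lemma mem_paramsErase {m : ℕ} {e : Fin m → ℂ} {j : Fin m} {x : ℂ} :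
    x ∈ paramsErase e j ↔ ∃ i, i ≠ j ∧ e i = x := by
  simp only [paramsErase, Multiset.mem_map, Finset.mem_val, Finset.mem_erase, Finset.mem_univ,
    and_true]

lemma cons_paramsErase {m : ℕ} (e : Fin m → ℂ) (j : Fin m) :
    e j ::ₘ paramsErase e j = params e := by
  rw [params, paramsErase, ← Multiset.map_cons e, Finset.erase_val,
    Multiset.cons_erase (Finset.mem_univ_val j)]

theorem circleAverage_kernel (hq0 : q ≠ 0) (hq1 : ‖q‖ < 1) (P : Multiset ℂ) {Q R : Multiset ℂ}
    {m : ℕ} {e : Fin m → ℂ} (he0 : ∀ j, e j ≠ 0) (hne : ∀ i j, i ≠ j → e i / e j ∉ Omega q)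
    {ρ : ℝ} (hρ : 0 < ρ) (heρ : ∀ j, ‖e j‖ < ρ) (hR : ∀ x ∈ R, ρ * ‖x‖ < 1)
    (hcard : Multiset.card Q ≤ m) (hprod : Multiset.card Q = m → ‖Q.prod‖ < ‖∏ j, e j‖)
    (hsum : ∀ j, Summable fun n : ℕ => (poch (q ^ n)⁻¹ q n * pochInf q q)⁻¹
      * kernel P Q R (paramsErase e j) q (e j * q ^ n)) :
    Real.circleAverage (kernel P Q R (params e) q) 0 ρ
      = ∑ j, ∑' n : ℕ, (poch (q ^ n)⁻¹ q n * pochInf q q)⁻¹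
        * kernel P Q R (paramsErase e j) q (e j * q ^ n) := by
  have hRw : ∀ w : ℂ, ‖w‖ ≤ ρ → ∀ x ∈ R, w * x ∉ Omega q := fun w hw x hx =>
    notMem_Omega_of_norm_lt_one hq0 hq1 <| by
      rw [norm_mul]
      exact (mul_le_mul_of_nonneg_right hw (norm_nonneg _)).trans_lt (hR x hx)
  obtain ⟨L, hL0, hL1, hdecay⟩ := exists_eventually_norm_kernel_mul_q_le hq0 hq1 P R (Q := Q)
    (S := params e) (by rwa [card_params]) (by simpa [mem_params] using he0)
    (by rwa [card_params, prod_params])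
  refine circleAverage_eq_sum_tsum_residues hq0 hq1 he0 hne hρ heρ (fun w hw hpole => ?_) hL0 hL1
    hdecay (fun j n => ?_) hsum
  · refine differentiableAt_kernel hq1 P Q hw.2 (hRw w (mem_closedBall_zero_iff.1 hw.1))
      fun x hx => ?_
    obtain ⟨j, rfl⟩ := mem_params.1 hx
    rw [inv_mul_mem_Omega_iff hq0 hw.2]
    exact fun ⟨n, hn⟩ => hpole j n hn
  · rw [← cons_paramsErase e j]
    refine tendsto_sub_smul_inv_smul_kernel_cons hq0 hq1 P Q (he0 j) n
      (hRw _ ((norm_mul_pow_le hq1 _ n).trans (heρ j).le)) fun x hx hmem => ?_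
    obtain ⟨i, hij, rfl⟩ := mem_paramsErase.1 hx
    obtain ⟨k, hk⟩ :=
      (inv_mul_mem_Omega_iff hq0 (mul_ne_zero (he0 j) (pow_ne_zero n hq0))).1 hmem
    have hpair := mul_pow_injective hq0 hq1 he0 hne (a₁ := (j, n)) (a₂ := (i, k)) hk
    exact hij (congrArg Prod.fst hpair).symm

end Kernel

section Series

variable {q : ℂ}

lemma pochM_add (S T : Multiset ℂ) (q : ℂ) (n : ℕ) :
    pochM (S + T) q n = pochM S q n * pochM T q n := by
  simp [pochM]

lemma pochM_replicate_zero (l : ℕ) (q : ℂ) (n : ℕ) : pochM (Multiset.replicate l 0) q n = 1 := by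
  simp [pochM, poch]

lemma tendsto_pochM (hq1 : ‖q‖ < 1) (S : Multiset ℂ) :
    Tendsto (pochM S q) atTop (𝓝 (pochInfM S q)) :=
  tendsto_multiset_prod S fun x _ => tendsto_poch hq1 x

lemma exists_norm_pochM_div_le (hq0 : q ≠ 0) (hq1 : ‖q‖ < 1) (as : Multiset ℂ) {bs : Multiset ℂ}
    (hbs : ∀ x ∈ bs, x ∉ Omega q) :
    ∃ M, ∀ n, ‖pochM as q n / (poch q q n * pochM bs q n)‖ ≤ M := by
  have hlim : Tendsto (fun n => pochM as q n / (poch q q n * pochM bs q n)) atTop (𝓝 _) :=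
    (tendsto_pochM hq1 as).div ((tendsto_poch hq1 q).mul (tendsto_pochM hq1 bs))
      (mul_ne_zero (pochInf_self_ne_zero hq0 hq1) (pochInfM_ne_zero hq1 hbs))
  obtain ⟨M, hM⟩ := hlim.norm.bddAbove_range
  exact ⟨M, fun n => hM ⟨n, rfl⟩⟩

lemma summable_pow_choose_two_pow_mul_pow (hq1 : ‖q‖ < 1) (s : ℕ) {z : ℂ}
    (hz : s = 0 → ‖z‖ < 1) :
    Summable fun n : ℕ => ‖((-1) ^ n * q ^ n.choose 2) ^ s * z ^ n‖ := by
  have hlim : Tendsto (fun n : ℕ => (‖q‖ ^ s) ^ n * ‖z‖) atTop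
      (𝓝 (if s = 0 then ‖z‖ else 0)) := by
    split_ifs with h
    · simp [h]
    · simpa using (tendsto_pow_atTop_nhds_zero_of_lt_one (by positivity)
        (pow_lt_one₀ (norm_nonneg q) hq1 h)).mul_const ‖z‖
  have hlt : (if s = 0 then ‖z‖ else 0) < 1 := by
    split_ifs with h
    · exact hz h
    · exact one_pos
  obtain ⟨r, hr, hr1⟩ := exists_between hlt
  refine summable_of_ratio_norm_eventually_le hr1 ?_
  filter_upwards [hlim.eventually_le_const hr] with n hn
  simp only [norm_norm, norm_mul, norm_pow, norm_neg, norm_one, one_pow, one_mul]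
  rw [Nat.choose_succ_succ' n 1, Nat.choose_one_right]
  calc (‖q‖ ^ (n + n.choose 2)) ^ s * ‖z‖ ^ (n + 1)
      = ((‖q‖ ^ s) ^ n * ‖z‖) * ((‖q‖ ^ n.choose 2) ^ s * ‖z‖ ^ n) := by ring
    _ ≤ r * _ := mul_le_mul_of_nonneg_right hn (by positivity)

lemma summable_norm_phiTerm (hq0 : q ≠ 0) (hq1 : ‖q‖ < 1) {as bs : Multiset ℂ} {s : ℕ}
    (hs : Multiset.card as + s = Multiset.card bs + 1) (hbs : ∀ x ∈ bs, x ∉ Omega q) {z : ℂ}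
    (hz : s = 0 → ‖z‖ < 1) : Summable fun n => ‖phiTerm as bs q z n‖ := by
  obtain ⟨M, hM⟩ := exists_norm_pochM_div_le hq0 hq1 as hbs
  have hexp : (Multiset.card bs : ℤ) + 1 - Multiset.card as = (s : ℕ) := by omega
  refine ((summable_pow_choose_two_pow_mul_pow hq1 s hz).mul_left M).of_nonneg_of_le
    (fun n => norm_nonneg _) fun n => ?_
  rw [phiTerm, hexp, zpow_natCast, mul_assoc, norm_mul]
  exact mul_le_mul_of_nonneg_right (hM n) (norm_nonneg _)

lemma differentiable_phi (hq0 : q ≠ 0) (hq1 : ‖q‖ < 1) {as bs : Multiset ℂ}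
    (hlt : Multiset.card as < Multiset.card bs + 1) (hbs : ∀ x ∈ bs, x ∉ Omega q) :
    Differentiable ℂ (phi as bs q) := by
  intro z
  obtain ⟨s, hs⟩ := Nat.exists_eq_add_of_lt hlt
  have hdiff : DifferentiableOn ℂ (fun w => ∑' n, phiTerm as bs q w n)
      (Metric.ball 0 (‖z‖ + 1)) := by
    refine Complex.differentiableOn_tsum_of_summable_norm
      (summable_norm_phiTerm hq0 hq1 (s := s + 1) hs.symm hbs (z := ((‖z‖ + 1 : ℝ) : ℂ)) (by simp))
      (fun n => ?_) Metric.isOpen_ball fun n w hw => ?_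
    · unfold phiTerm
      fun_prop
    · unfold phiTerm
      rw [norm_mul _ (w ^ n), norm_mul _ (_ ^ n), norm_pow, norm_pow, Complex.norm_real,
        Real.norm_of_nonneg (by positivity)]
      exact mul_le_mul_of_nonneg_left (pow_le_pow_left₀ (norm_nonneg w)
        (mem_ball_zero_iff.1 hw).le n) (norm_nonneg _)
  exact hdiff.differentiableAt (Metric.isOpen_ball.mem_nhds (by simp))

lemma phiZTerm_eq (m : ℤ) (as bs : Multiset ℂ) (q z : ℂ) (n : ℕ) :
    phiZTerm m as bs q z n = pochM as q n / (poch q q n * pochM bs q n)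
      * ((-1) ^ n * q ^ n.choose 2) ^ ((Multiset.card bs : ℤ) + 1 + m - Multiset.card as)
      * z ^ n := by
  have hcard : ((Multiset.card bs + m.toNat : ℕ) : ℤ) + 1
      - ((Multiset.card as + (-m).toNat : ℕ) : ℤ)
      = Multiset.card bs + 1 + m - Multiset.card as := by omega
  simp only [phiZTerm, phiTerm, pochM_add, pochM_replicate_zero, mul_one, Multiset.card_add,
    Multiset.card_replicate, hcard]

lemma summable_phiZTerm (hq0 : q ≠ 0) (hq1 : ‖q‖ < 1) {m : ℤ} {as bs : Multiset ℂ} {s : ℕ}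
    (hs : Multiset.card as + (s : ℤ) = Multiset.card bs + 1 + m) (hbs : ∀ x ∈ bs, x ∉ Omega q)
    {z : ℂ} (hz : s = 0 → ‖z‖ < 1) : Summable (phiZTerm m as bs q z) := by
  have hzero : (0 : ℂ) ∉ Omega q := notMem_Omega_of_norm_lt_one hq0 hq1 (by simp)
  refine (summable_norm_phiTerm hq0 hq1 (s := s) ?_ (fun x hx => ?_) hz).of_norm
  · simp only [Multiset.card_add, Multiset.card_replicate]
    omega
  · rcases Multiset.mem_add.1 hx with hx | hx
    · exact hbs x hx
    · rwa [Multiset.eq_of_mem_replicate hx]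

end Series

section Residues

variable {q : ℂ}

lemma divM_eq_smulM_inv (S : Multiset ℂ) (b : ℂ) : divM S b = smulM b⁻¹ S :=
  Multiset.map_congr rfl fun x _ => div_eq_inv_mul x b

lemma pochM_ne_zero {S : Multiset ℂ} (hS : ∀ x ∈ S, x ∉ Omega q) (n : ℕ) : pochM S q n ≠ 0 :=
  prod_map_ne_zero fun x hx => poch_ne_zero (hS x hx) n

lemma pochInfM_smulM_mul_pow (hq1 : ‖q‖ < 1) {b : ℂ} {S : Multiset ℂ}
    (hS : ∀ x ∈ S, b * x ∉ Omega q) (n : ℕ) :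
    pochInfM (smulM (b * q ^ n) S) q = pochInfM (smulM b S) q / pochM (smulM b S) q n := by
  rw [eq_div_iff (pochM_ne_zero (by simpa [smulM] using hS) n), mul_comm, pochInfM_smulM,
    pochInfM_smulM, pochM, smulM, Multiset.map_map, ← Multiset.prod_map_mul]
  refine congrArg Multiset.prod (Multiset.map_congr rfl fun x _ => ?_)
  rw [Function.comp_apply, pochInf_eq_poch_mul hq1 (b * x) n, mul_right_comm]

lemma pochInfM_smulM_inv_mul_pow (hq0 : q ≠ 0) (hq1 : ‖q‖ < 1) {b : ℂ} (hb : b ≠ 0)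
    {S : Multiset ℂ} (hS : ∀ x ∈ S, x ≠ 0) (n : ℕ) :
    pochInfM (smulM (b * q ^ n)⁻¹ S) q = pochInfM (smulM b⁻¹ S) q * (pochM (divByM (q * b) S) q n
      * (S.prod ^ n * (((-1) ^ n * q ^ n.choose 2 * (q * b) ^ n)⁻¹) ^ Multiset.card S)) := by
  induction S using Multiset.induction_on with
  | empty => simp [pochInfM, smulM, divByM, pochM]
  | cons x S ih =>
    have hx : x ≠ 0 := hS x (Multiset.mem_cons_self x S)
    have hx_mul := pochInf_mul_inv_pow hq0 hq1 (mul_ne_zero (inv_ne_zero hb) hx) n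
    rw [show b⁻¹ * x * (q ^ n)⁻¹ = (b * q ^ n)⁻¹ * x by rw [mul_inv]; ring,
      show q / (b⁻¹ * x) = q * b / x by field_simp] at hx_mul
    rw [pochInfM_smulM_cons, pochInfM_smulM_cons, ih fun y hy => hS y (Multiset.mem_cons_of_mem hy),
      hx_mul]
    simp only [divByM, pochM, Multiset.map_cons, Multiset.prod_cons, Multiset.card_cons, mul_pow,
      mul_inv, inv_pow, pow_succ]
    ring

lemma kernel_mul_pow (hq0 : q ≠ 0) (hq1 : ‖q‖ < 1) {P Q R T : Multiset ℂ} {x : ℂ} (hx : x ≠ 0)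
    (hP : ∀ y ∈ P, x * y ∉ Omega q) (hQ : ∀ y ∈ Q, y ≠ 0) (hR : ∀ y ∈ R, x * y ∉ Omega q)
    (hT : ∀ y ∈ T, y ≠ 0) (n : ℕ) :
    kernel P Q R T q (x * q ^ n) = kernel P Q R T q x
      * (pochM (smulM x R + divByM (q * x) Q) q n / pochM (smulM x P + divByM (q * x) T) q n)
      * ((Q.prod / T.prod) ^ n * ((-1) ^ n * q ^ n.choose 2 * (q * x) ^ n)
        ^ ((Multiset.card T : ℤ) - Multiset.card Q)) := by
  have hsign : (-1 : ℂ) ^ n ≠ 0 := pow_ne_zero n (by norm_num)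
  have hτ : (-1) ^ n * q ^ n.choose 2 * (q * x) ^ n ≠ 0 :=
    mul_ne_zero (mul_ne_zero hsign (pow_ne_zero _ hq0)) (pow_ne_zero n (mul_ne_zero hq0 hx))
  rw [kernel, kernel, pochInfM_smulM_mul_pow hq1 hP, pochInfM_smulM_mul_pow hq1 hR,
    pochInfM_smulM_inv_mul_pow hq0 hq1 hx hQ, pochInfM_smulM_inv_mul_pow hq0 hq1 hx hT, pochM_add,
    pochM_add, zpow_sub₀ hτ, zpow_natCast, zpow_natCast]
  generalize (-1) ^ n * q ^ n.choose 2 * (q * x) ^ n = τ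
  simp only [div_eq_mul_inv, mul_inv, inv_inv, inv_pow, mul_pow Q.prod]
  ring

/-- The `n`-th term of the basic hypergeometric series formed by the residues of
`ϑ(u w, v / w; q) (P w, Q / w; q)_∞ / (R w, T / w, x / w; q)_∞` at the poles `w = x q ^ n`. -/
def residueTerm (u v : ℂ) (P Q R T : Multiset ℂ) (q x : ℂ) (n : ℕ) : ℂ :=
  phiZTerm ((Multiset.card R : ℤ) - Multiset.card P - 2) (smulM x R + divByM (q * x) Q)
    (smulM x P + divByM (q * x) T) q
    (q * v * Q.prod * (q * x) ^ ((Multiset.card T : ℤ) - Multiset.card Q - 1)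
      / (u * (x * T.prod))) n

lemma poch_inv_pow_eq (hq0 : q ≠ 0) (n : ℕ) :
    poch (q ^ n)⁻¹ q n = poch q q n * (((-1) ^ n * q ^ n.choose 2)⁻¹ * (q ^ n)⁻¹) := by
  simpa using poch_mul_inv_pow hq0 one_ne_zero n

lemma kernel_theta (hq0 : q ≠ 0) {u v w : ℂ} (hu : u ≠ 0) (hv : v ≠ 0) (hw : w ≠ 0)
    (P Q R S : Multiset ℂ) :
    kernel ({u, q / v} + P) ({v, q / u} + Q) R S q w
      = theta (u * w) q * theta (v / w) q * kernel P Q R S q w := by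
  have hqv : w * (q / v) = q / (v / w) := by field_simp
  have hqu : w⁻¹ * (q / u) = q / (u * w) := by field_simp
  simp only [kernel, theta, smulM_add, pochInfM_add, Multiset.insert_eq_cons,
    ← Multiset.cons_zero, pochInfM_smulM_cons, hqv, hqu, mul_comm w u, inv_mul_eq_div w v]
  simp only [smulM, pochInfM, Multiset.map_zero, Multiset.prod_zero]
  ring

lemma residueTerm_eq (u v : ℂ) (P Q R T : Multiset ℂ) (q x : ℂ) (n : ℕ) :
    residueTerm u v P Q R T q x n
      = pochM (smulM x R + divByM (q * x) Q) q n
          / (poch q q n * pochM (smulM x P + divByM (q * x) T) q n)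
        * ((-1) ^ n * q ^ n.choose 2) ^ ((Multiset.card T : ℤ) - Multiset.card Q - 1)
        * (q * v * Q.prod * (q * x) ^ ((Multiset.card T : ℤ) - Multiset.card Q - 1)
          / (u * (x * T.prod))) ^ n := by
  have hexp : (Multiset.card (smulM x P + divByM (q * x) T) : ℤ) + 1
      + ((Multiset.card R : ℤ) - Multiset.card P - 2)
      - Multiset.card (smulM x R + divByM (q * x) Q)
      = Multiset.card T - Multiset.card Q - 1 := by
    simp only [smulM, divByM, Multiset.card_add, Multiset.card_map]
    omega
  rw [residueTerm, phiZTerm_eq, hexp]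

lemma residue_eq_residueTerm (hq0 : q ≠ 0) (hq1 : ‖q‖ < 1) {u v : ℂ} (hu : u ≠ 0) (hv : v ≠ 0)
    {P Q R T : Multiset ℂ} {x : ℂ} (hx : x ≠ 0)
    (hP : ∀ y ∈ P, x * y ∉ Omega q) (hQ : ∀ y ∈ Q, y ≠ 0) (hR : ∀ y ∈ R, x * y ∉ Omega q)
    (hT : ∀ y ∈ T, y ≠ 0) (n : ℕ) :
    (poch (q ^ n)⁻¹ q n * pochInf q q)⁻¹
        * kernel ({u, q / v} + P) ({v, q / u} + Q) R T q (x * q ^ n)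
      = theta (u * x) q * theta (v / x) q * kernel P Q R T q x / pochInf q q
        * residueTerm u v P Q R T q x n := by
  have hqn := pow_ne_zero n hq0
  have hqx := mul_ne_zero hq0 hx
  have hτ0 : (-1) ^ n * q ^ n.choose 2 ≠ 0 :=
    mul_ne_zero (pow_ne_zero n (by norm_num)) (pow_ne_zero _ hq0)
  rw [kernel_theta hq0 hu hv (mul_ne_zero hx hqn), ← mul_assoc u, ← div_div v,
    div_eq_mul_inv _ (q ^ n),
    theta_mul_pow_mul_theta_mul_inv_pow hq0 hq1 (mul_ne_zero hu hx) (div_ne_zero hv hx),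
    kernel_mul_pow hq0 hq1 hx hP hQ hR hT, residueTerm_eq, poch_inv_pow_eq hq0]
  generalize (-1) ^ n * q ^ n.choose 2 = τ at hτ0 ⊢
  generalize (Multiset.card T : ℤ) - Multiset.card Q = l
  have hpow : (v / x / (u * x)) ^ n * (τ ^ 2 * q ^ n)⁻¹
        * ((Q.prod / T.prod) ^ n * (τ * (q * x) ^ n) ^ l) * (τ⁻¹ * (q ^ n)⁻¹)⁻¹
      = τ ^ (l - 1) * (q * v * Q.prod * (q * x) ^ (l - 1) / (u * (x * T.prod))) ^ n := by
    have hcomm : ((q * x) ^ n) ^ l = ((q * x) ^ l) ^ n := by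
      rw [← zpow_natCast, ← zpow_natCast, zpow_comm]
    rw [mul_zpow, hcomm, zpow_sub_one₀ hτ0, zpow_sub_one₀ hqx]
    simp only [mul_pow, div_pow, inv_pow]
    field_simp
  linear_combination (theta (u * x) q * theta (v / x) q * kernel P Q R T q x / pochInf q q
    * (pochM (smulM x R + divByM (q * x) Q) q n
      / (poch q q n * pochM (smulM x P + divByM (q * x) T) q n))) * hpow

lemma q_mul_div_notMem_Omega (hq0 : q ≠ 0) {m : ℕ} {e : Fin m → ℂ}
    (hne : ∀ i j, i ≠ j → e i / e j ∉ Omega q) (j : Fin m) :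
    ∀ y ∈ divByM (q * e j) (paramsErase e j), y ∉ Omega q := by
  intro y hy
  obtain ⟨x, hx, rfl⟩ := Multiset.mem_map.1 hy
  obtain ⟨i, hij, rfl⟩ := mem_paramsErase.1 hx
  rw [mul_div_assoc]
  exact q_mul_notMem_Omega hq0 (hne j i hij.symm)

lemma card_paramsErase_add_one {m : ℕ} (e : Fin m → ℂ) (j : Fin m) :
    Multiset.card (paramsErase e j) + 1 = m := by
  rw [← Multiset.card_cons (e j), cons_paramsErase, card_params]

lemma mul_prod_paramsErase {m : ℕ} (e : Fin m → ℂ) (j : Fin m) :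
    e j * (paramsErase e j).prod = ∏ i, e i := by
  rw [← Multiset.prod_cons, cons_paramsErase, prod_params]

lemma summable_residueTerm (hq0 : q ≠ 0) (hq1 : ‖q‖ < 1) {u v : ℂ} (hu : u ≠ 0)
    {P Q : Multiset ℂ} (R : Multiset ℂ) {m : ℕ} {e : Fin m → ℂ} (he0 : ∀ j, e j ≠ 0)
    (hne : ∀ i j, i ≠ j → e i / e j ∉ Omega q) (hP : ∀ j, ∀ x ∈ P, e j * x ∉ Omega q)
    (hcard : Multiset.card Q + 2 ≤ m)
    (hprod : Multiset.card Q + 2 = m → ‖q * v * Q.prod‖ < ‖u * ∏ j, e j‖) (j : Fin m) :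
    Summable (residueTerm u v P Q R (paramsErase e j) q (e j)) := by
  have hcard_e := card_paramsErase_add_one e j
  obtain ⟨s, hs⟩ := Nat.exists_eq_add_of_le hcard
  have hT : (Multiset.card (paramsErase e j) : ℤ) - Multiset.card Q - 1 = (s : ℕ) := by omega
  unfold residueTerm
  refine summable_phiZTerm hq0 hq1 (s := s) ?_ (fun y hy => ?_) fun hs0 => ?_
  · simp only [smulM, divByM, Multiset.card_add, Multiset.card_map]
    omega
  · rcases Multiset.mem_add.1 hy with hy | hy
    · obtain ⟨x, hx, rfl⟩ := Multiset.mem_map.1 hy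
      exact hP j x hx
    · exact q_mul_div_notMem_Omega hq0 hne j y hy
  · have hpos : u * ∏ i, e i ≠ 0 := mul_ne_zero hu (Finset.prod_ne_zero_iff.2 fun i _ => he0 i)
    rw [hT, hs0, Nat.cast_zero, zpow_zero, mul_one, mul_prod_paramsErase, norm_div,
      div_lt_one (norm_pos_iff.2 hpos)]
    exact hprod (by omega)

theorem circleAverage_kernel_theta (hq0 : q ≠ 0) (hq1 : ‖q‖ < 1) {u v : ℂ} (hu : u ≠ 0)
    (hv : v ≠ 0) {P Q R : Multiset ℂ} {m : ℕ} {e : Fin m → ℂ} (he0 : ∀ j, e j ≠ 0)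
    (hne : ∀ i j, i ≠ j → e i / e j ∉ Omega q) {ρ : ℝ} (heρ : ∀ j, ‖e j‖ < ρ)
    (hP : ∀ j, ∀ x ∈ P, e j * x ∉ Omega q) (hQ : ∀ x ∈ Q, x ≠ 0) (hR : ∀ x ∈ R, ρ * ‖x‖ < 1)
    (hcard : Multiset.card Q + 2 ≤ m)
    (hprod : Multiset.card Q + 2 = m → ‖q * v * Q.prod‖ < ‖u * ∏ j, e j‖) :
    Real.circleAverage (kernel ({u, q / v} + P) ({v, q / u} + Q) R (params e) q) 0 ρ
      = ∑ j, theta (u * e j) q * theta (v / e j) q * kernel P Q R (paramsErase e j) q (e j)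
        / pochInf q q * ∑' n, residueTerm u v P Q R (paramsErase e j) q (e j) n := by
  have hρ : 0 < ρ := (norm_nonneg _).trans_lt (heρ ⟨0, by omega⟩)
  have hterm (j : Fin m) := residue_eq_residueTerm hq0 hq1 hu hv (he0 j) (hP j) hQ
    (fun x hx => notMem_Omega_of_norm_lt_one hq0 hq1 <| by
      rw [norm_mul]
      exact (mul_le_mul_of_nonneg_right (heρ j).le (norm_nonneg x)).trans_lt (hR x hx))
    (T := paramsErase e j) fun x hx => by
      obtain ⟨i, -, rfl⟩ := mem_paramsErase.1 hx
      exact he0 i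
  rw [circleAverage_kernel hq0 hq1 _ he0 hne hρ heρ hR]
  · simp only [hterm, tsum_mul_left]
  · simp only [Multiset.insert_eq_cons, Multiset.card_add, Multiset.card_cons,
      Multiset.card_singleton]
    omega
  · intro h
    simp only [Multiset.insert_eq_cons, Multiset.card_add, Multiset.card_cons,
      Multiset.card_singleton] at h
    have hlt := hprod (by omega)
    rw [norm_mul u] at hlt
    simp only [Multiset.prod_add, Multiset.insert_eq_cons, Multiset.prod_cons,
      Multiset.prod_singleton]
    rw [show v * (q / u) * Q.prod = q * v * Q.prod / u by ring, norm_div,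
      div_lt_iff₀' (norm_pos_iff.2 hu)]
    exact hlt
  · intro j
    simp only [hterm]
    exact (summable_residueTerm hq0 hq1 hu R he0 hne hP hcard hprod j).mul_left _

end Residues

section Integrand

variable {q : ℂ} {A C : ℕ}

lemma paramsErase_pair_zero (d₁ d₂ : ℂ) : paramsErase ![d₁, d₂] 0 = {d₂} := rfl

lemma paramsErase_pair_one (d₁ d₂ : ℂ) : paramsErase ![d₁, d₂] 1 = {d₁} := rfl

lemma integrand_eq_kernel (a : Fin A → ℂ) (c : Fin C → ℂ) (d₁ d₂ f q : ℂ) (σ ψ : ℝ) :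
    integrand a c d₁ d₂ f q σ ψ = kernel ({f / d₂, q / (f * d₁)} + params a) {f * d₁, q / f * d₂}
      (params c) (params ![d₁, d₂]) q (circleMap 0 σ⁻¹ ψ) := by
  have hw : circleMap 0 σ⁻¹ ψ = Complex.exp (Complex.I * ψ) / σ := by
    rw [circleMap_zero, Complex.ofReal_inv, mul_comm Complex.I, div_eq_inv_mul]
  have hd : params ![d₁, d₂] = {d₁, d₂} := rfl
  simp only [integrand, kernel, hw, inv_div, hd]
  ring

lemma continuous_integrand (hq0 : q ≠ 0) (hq1 : ‖q‖ < 1) (a : Fin A → ℂ) {c : Fin C → ℂ}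
    {d₁ d₂ : ℂ} (f : ℂ) {σ : ℝ} (hσ : 0 < σ) (hcσ : ∀ k, ‖c k‖ < σ) (hd₁σ : ‖d₁‖ < 1 / σ)
    (hd₂σ : ‖d₂‖ < 1 / σ) : Continuous (integrand a c d₁ d₂ f q σ) := by
  have hnorm (ψ : ℝ) : ‖circleMap 0 σ⁻¹ ψ‖ = σ⁻¹ := by
    rw [norm_circleMap_zero, abs_of_pos (inv_pos.2 hσ)]
  rw [funext (integrand_eq_kernel a c d₁ d₂ f q σ), continuous_iff_continuousAt]
  intro ψ
  refine ContinuousAt.comp (g := kernel _ _ _ _ q) (f := circleMap 0 σ⁻¹)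
    (differentiableAt_kernel hq1 _ _ ?_ (fun x hx => ?_) fun x hx => ?_).continuousAt
    (continuous_circleMap 0 σ⁻¹).continuousAt
  · exact circleMap_ne_center (inv_ne_zero hσ.ne')
  · obtain ⟨k, rfl⟩ := mem_params.1 hx
    refine notMem_Omega_of_norm_lt_one hq0 hq1 ?_
    rw [norm_mul, hnorm, inv_mul_lt_one₀ hσ]
    exact hcσ k
  · obtain ⟨j, rfl⟩ := mem_params.1 hx
    refine notMem_Omega_of_norm_lt_one hq0 hq1 ?_
    rw [norm_mul, norm_inv, hnorm, inv_inv, ← lt_div_iff₀' hσ]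
    fin_cases j
    · exact hd₁σ
    · exact hd₂σ

lemma residueTerm_eq_hTerm (a : Fin A → ℂ) (c : Fin C → ℂ) {u v d₁ d₂ : ℂ} (hu : u ≠ 0)
    (hd₁ : d₁ ≠ 0) (hd₂ : d₂ ≠ 0) (hv : v = u * (d₁ * d₂)) (q : ℂ) (n : ℕ) :
    residueTerm u v (params a) 0 (params c) {d₂} q d₁ n = hTerm a c d₁ d₂ q n := by
  have harg : q * (u * (d₁ * d₂)) / (u * (d₁ * d₂)) = q :=
    mul_div_cancel_right₀ q (mul_ne_zero hu (mul_ne_zero hd₁ hd₂))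
  simp [residueTerm, hTerm, card_params, divByM, hv, harg]

lemma kernel_mul_tsum_hTerm (a : Fin A → ℂ) (c : Fin C → ℂ) (d₁ d₂ q : ℂ) :
    kernel (params a) 0 (params c) {d₂} q d₁ * ∑' n, hTerm a c d₁ d₂ q n
      = hSummand a c d₁ d₂ q := by
  have hkernel : kernel (params a) 0 (params c) {d₂} q d₁ = pochInfM (smulM d₁ (params a)) q
      / (pochInf (d₂ / d₁) q * pochInfM (smulM d₁ (params c)) q) := by
    simp [kernel, smulM, pochInfM, div_eq_inv_mul, mul_comm]
  rw [hkernel]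
  rfl

lemma summable_hTerm (hq0 : q ≠ 0) (hq1 : ‖q‖ < 1) {a : Fin A → ℂ} (c : Fin C → ℂ) {d₁ d₂ : ℂ}
    (h12 : d₁ / d₂ ∉ Omega q) (ha : ∀ i, d₁ * a i ∉ Omega q) : Summable (hTerm a c d₁ d₂ q) := by
  refine summable_phiZTerm hq0 hq1 (s := 0) ?_ (fun y hy => ?_) fun _ => hq1
  · simp only [smulM, Multiset.card_add, Multiset.card_map, Multiset.card_singleton, card_params]
    omega
  · rcases Multiset.mem_add.1 hy with hy | hy
    · obtain ⟨x, hx, rfl⟩ := Multiset.mem_map.1 hy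
      obtain ⟨i, rfl⟩ := mem_params.1 hx
      exact ha i
    · rw [Multiset.mem_singleton.1 hy, mul_div_assoc]
      exact q_mul_notMem_Omega hq0 h12

theorem integral_integrand_eq_H (hq0 : q ≠ 0) (hq1 : ‖q‖ < 1) {a : Fin A → ℂ} {c : Fin C → ℂ}
    {d₁ d₂ f : ℂ} (hd₁ : d₁ ≠ 0) (hd₂ : d₂ ≠ 0) (hf : f ≠ 0) {σ : ℝ} (hσ : 0 < σ)
    (hcσ : ∀ k, ‖c k‖ < σ) (hd₁σ : ‖d₁‖ < 1 / σ) (hd₂σ : ‖d₂‖ < 1 / σ)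
    (h12 : d₁ / d₂ ∉ Omega q) (h21 : d₂ / d₁ ∉ Omega q)
    (ha : ∀ i, d₁ * a i ∉ Omega q ∧ d₂ * a i ∉ Omega q) :
    ∫ ψ in (-Real.pi)..Real.pi, integrand a c d₁ d₂ f q σ ψ
      = 2 * Real.pi * (theta f q * theta (f * (d₁ / d₂)) q) / pochInf q q * H a c d₁ d₂ q := by
  have hu : f / d₂ ≠ 0 := div_ne_zero hf hd₂
  have hQ : ({f * d₁, q / f * d₂} : Multiset ℂ) = {f * d₁, q / (f / d₂)} + 0 := by
    rw [add_zero, ← div_mul]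
  have hu₂ : f / d₂ * d₂ = f := div_mul_cancel₀ f hd₂
  have hv₁ : f * d₁ / d₁ = f := mul_div_cancel_right₀ f hd₁
  have hv : f * d₁ = f / d₂ * (d₁ * d₂) := by rw [mul_comm d₁, ← mul_assoc, hu₂]
  have hprod : ‖q * (f * d₁)‖ < ‖f / d₂ * (d₁ * d₂)‖ := by
    rw [← hv, norm_mul]
    exact mul_lt_of_lt_one_left (norm_pos_iff.2 (mul_ne_zero hf hd₁)) hq1
  have hu₁ : f / d₂ * d₁ = f * (d₁ / d₂) := by ring
  have hv₂ : f * d₁ / d₂ = f * (d₁ / d₂) := mul_div_assoc f d₁ d₂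
  simp only [integrand_eq_kernel, integral_circleMap_eq_smul_circleAverage, hQ]
  rw [circleAverage_kernel_theta hq0 hq1 hu (mul_ne_zero hf hd₁) (Fin.forall_fin_two.2 ⟨hd₁, hd₂⟩)]
  · simp only [Fin.sum_univ_two, paramsErase_pair_zero, paramsErase_pair_one, Matrix.cons_val_zero,
      Matrix.cons_val_one, residueTerm_eq_hTerm a c hu hd₁ hd₂ hv,
      residueTerm_eq_hTerm a c hu hd₂ hd₁ (hv.trans (by rw [mul_comm d₁])), hu₁, hu₂, hv₁, hv₂, H,
      ← kernel_mul_tsum_hTerm, Complex.real_smul]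
    push_cast
    ring
  · simp [Fin.forall_fin_two, h12, h21]
  · simpa [Fin.forall_fin_two] using And.intro hd₁σ hd₂σ
  · intro j x hx
    obtain ⟨i, rfl⟩ := mem_params.1 hx
    fin_cases j
    · exact (ha i).1
    · exact (ha i).2
  · simp
  · intro x hx
    obtain ⟨k, rfl⟩ := mem_params.1 hx
    rw [inv_mul_lt_one₀ hσ]
    exact hcσ k
  · simp
  · simpa [Fin.prod_univ_two] using hprod

lemma residueTerm_eq_phiTerm (a : Fin A → ℂ) (c : Fin C → ℂ) {d₁ d₂ f : ℂ} (hd₂ : d₂ ≠ 0)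
    (hf : f ≠ 0) (q : ℂ) (k : Fin C) (n : ℕ) :
    residueTerm (f * d₁) (f / d₂) 0 (params a) {d₁, d₂} (paramsErase c k) q (c k) n
      = phiTerm (jNum a c d₁ d₂ q k) (jDen c q k) q (jArg a c d₁ d₂ q k) n := by
  have hexp : (Multiset.card (paramsErase c k) : ℤ) - A - 1 = C - A - 2 := by
    have hcard := card_paramsErase_add_one c k
    omega
  have harg : q * (f / d₂) * (∏ i, a i) * (q * c k) ^ ((C : ℤ) - A - 2) / (f * d₁ * ∏ j, c j)
      = jArg a c d₁ d₂ q k := by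
    rw [jArg]
    field_simp
  simp [residueTerm, phiZTerm, card_params, prod_params, mul_prod_paramsErase, hexp, harg, jNum,
    jDen, smulM]

lemma kernel_zero_eq (Q R T : Multiset ℂ) (q x : ℂ) :
    kernel 0 Q R T q x
      = pochInfM (divM Q x) q / (pochInfM (smulM x R) q * pochInfM (divM T x) q) := by
  simp [kernel, divM_eq_smulM_inv, pochInfM_smulM]

lemma card_jNum (a : Fin A → ℂ) (c : Fin C → ℂ) (d₁ d₂ q : ℂ) (k : Fin C) :
    Multiset.card (jNum a c d₁ d₂ q k) = A + 2 := by
  simp only [jNum, smulM, divByM, Multiset.card_add, Multiset.card_map, Multiset.card_pair,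
    card_params, add_comm]

lemma card_jDen_add_one (c : Fin C → ℂ) (q : ℂ) (k : Fin C) :
    Multiset.card (jDen c q k) + 1 = C := by
  rw [jDen, divByM, Multiset.card_map, card_paramsErase_add_one]

lemma norm_mul_div_lt {x y d₁ d₂ f : ℂ} (hd₂ : d₂ ≠ 0) (hf : f ≠ 0)
    (h : ‖q * x‖ < ‖d₁ * d₂ * y‖) : ‖q * (f / d₂) * x‖ < ‖f * d₁ * y‖ := by
  have hleft : q * (f / d₂) * x = f / d₂ * (q * x) := by ring
  have hright : f * d₁ * y = f / d₂ * (d₁ * d₂ * y) := by field_simp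
  rw [hleft, hright, norm_mul (f / d₂), norm_mul (f / d₂)]
  exact mul_lt_mul_of_pos_left h (norm_pos_iff.2 (div_ne_zero hf hd₂))

lemma summable_phiTerm_jArg (hq0 : q ≠ 0) (hq1 : ‖q‖ < 1) (a : Fin A → ℂ) {c : Fin C → ℂ}
    (d₁ d₂ : ℂ) (hAC : A + 2 ≤ C) (hne : ∀ i j, i ≠ j → c i / c j ∉ Omega q)
    (hprod : C = A + 2 → ‖q * ∏ i, a i‖ < ‖d₁ * d₂ * ∏ k, c k‖) (k : Fin C) :
    Summable (phiTerm (jNum a c d₁ d₂ q k) (jDen c q k) q (jArg a c d₁ d₂ q k)) := by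
  have hnum := card_jNum a c d₁ d₂ q k
  have hden := card_jDen_add_one c q k
  refine (summable_norm_phiTerm hq0 hq1 (s := C - (A + 2)) (bs := jDen c q k) (by omega)
    (q_mul_div_notMem_Omega hq0 hne k) fun hs => ?_).of_norm
  have hC : C = A + 2 := by omega
  have hlt := hprod hC
  have hexp : (C : ℤ) - A - 2 = 0 := by omega
  rwa [jArg, hexp, zpow_zero, mul_one, norm_div, div_lt_one ((norm_nonneg _).trans_lt hlt)]

theorem integral_integrand_eq_J (hq0 : q ≠ 0) (hq1 : ‖q‖ < 1) {a : Fin A → ℂ} {c : Fin C → ℂ}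
    {d₁ d₂ f : ℂ} (hd₁ : d₁ ≠ 0) (hd₂ : d₂ ≠ 0) (hf : f ≠ 0) {σ : ℝ} (hσ : 0 < σ)
    (hcσ : ∀ k, ‖c k‖ < σ) (hd₁σ : ‖d₁‖ < 1 / σ) (hd₂σ : ‖d₂‖ < 1 / σ) (hAC : A + 2 ≤ C)
    (ha : ∀ i, a i ≠ 0) (hc : ∀ k, c k ≠ 0) (hne : ∀ i j, i ≠ j → c i / c j ∉ Omega q)
    (hprod : C = A + 2 → ‖q * ∏ i, a i‖ < ‖d₁ * d₂ * ∏ k, c k‖) :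
    ∫ ψ in (-Real.pi)..Real.pi, integrand a c d₁ d₂ f q σ ψ
      = 2 * Real.pi / pochInf q q * J a c d₁ d₂ f q := by
  have hinv : kernel ({f / d₂, q / (f * d₁)} + params a) {f * d₁, q / f * d₂} (params c)
      (params ![d₁, d₂]) q
      = fun w => kernel ({f * d₁, q / (f / d₂)} + 0) ({f / d₂, q / (f * d₁)} + params a)
          {d₁, d₂} (params c) q w⁻¹ := by
    funext w
    rw [kernel_inv, add_zero, ← div_mul]
    rfl
  have hv (k : Fin C) : f / d₂ / c k = f / (c k * d₂) := by rw [div_div, mul_comm d₂]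
  simp only [integrand_eq_kernel]
  rw [integral_circleMap_eq_smul_circleAverage, hinv, circleAverage_comp_inv,
    circleAverage_kernel_theta hq0 hq1 (mul_ne_zero hf hd₁) (div_ne_zero hf hd₂) hc hne hcσ]
  · simp only [residueTerm_eq_phiTerm a c hd₂ hf, kernel_zero_eq, hv, J, phi, Complex.real_smul,
      Finset.mul_sum, mul_right_comm f d₁]
    refine Finset.sum_congr rfl fun k _ => ?_
    push_cast
    ring
  · simp
  · simpa [mem_params] using ha
  · simpa [← lt_div_iff₀' hσ] using And.intro hd₁σ hd₂σ
  · simpa [card_params] using hAC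
  · intro h
    rw [card_params] at h
    exact norm_mul_div_lt hd₂ hf (hprod h.symm)

end Integrand

end QHyp

end

theorem mainTheorem2 (q : ℂ) (hq0 : q ≠ 0) (hq1 : ‖q‖ < 1) (A C : ℕ)
    (a : Fin A → ℂ) (c : Fin C → ℂ) (d₁ d₂ f : ℂ) (hd₁ : d₁ ≠ 0) (hd₂ : d₂ ≠ 0) (hf : f ≠ 0)
    (σ : ℝ) (hσ : 0 < σ) (hcσ : ∀ k, ‖c k‖ < σ) (hd₁σ : ‖d₁‖ < 1 / σ) (hd₂σ : ‖d₂‖ < 1 / σ) :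
    IntervalIntegrable (QHyp.integrand a c d₁ d₂ f q σ) volume (-Real.pi) Real.pi ∧
    (d₁ / d₂ ∉ QHyp.Omega q → d₂ / d₁ ∉ QHyp.Omega q →
      (∀ i, d₁ * a i ∉ QHyp.Omega q ∧ d₂ * a i ∉ QHyp.Omega q) →
      Summable (QHyp.hTerm a c d₁ d₂ q) ∧ Summable (QHyp.hTerm a c d₂ d₁ q) ∧
      ∫ ψ in (-Real.pi)..Real.pi, QHyp.integrand a c d₁ d₂ f q σ ψ
        = 2 * Real.pi * (QHyp.theta f q * QHyp.theta (f * (d₁ / d₂)) q) / QHyp.pochInf q q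
          * QHyp.H a c d₁ d₂ q) ∧
    (A + 2 ≤ C → (∀ i, a i ≠ 0) → (∀ k, c k ≠ 0) →
      (∀ k k', k ≠ k' → c k / c k' ∉ QHyp.Omega q) →
      (C = A + 2 → ‖q * ∏ i, a i‖ < ‖d₁ * d₂ * ∏ k, c k‖) →
      (∀ k, Summable
        (QHyp.phiTerm (QHyp.jNum a c d₁ d₂ q k) (QHyp.jDen c q k) q (QHyp.jArg a c d₁ d₂ q k))) ∧
      (A + 2 < C → ∀ k,
        (∀ x, Summable (QHyp.phiTerm (QHyp.jNum a c d₁ d₂ q k) (QHyp.jDen c q k) q x)) ∧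
        Differentiable ℂ (QHyp.phi (QHyp.jNum a c d₁ d₂ q k) (QHyp.jDen c q k) q)) ∧
      ∫ ψ in (-Real.pi)..Real.pi, QHyp.integrand a c d₁ d₂ f q σ ψ
        = 2 * Real.pi / QHyp.pochInf q q * QHyp.J a c d₁ d₂ f q) := by
  refine ⟨(QHyp.continuous_integrand hq0 hq1 a f hσ hcσ hd₁σ hd₂σ).intervalIntegrable _ _,
    fun h12 h21 ha => ⟨QHyp.summable_hTerm hq0 hq1 c h12 fun i => (ha i).1,
      QHyp.summable_hTerm hq0 hq1 c h21 fun i => (ha i).2,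
      QHyp.integral_integrand_eq_H hq0 hq1 hd₁ hd₂ hf hσ hcσ hd₁σ hd₂σ h12 h21 ha⟩,
    fun hAC ha hc hne hprod => ⟨QHyp.summable_phiTerm_jArg hq0 hq1 a d₁ d₂ hAC hne hprod,
      fun hlt k => ?_,
      QHyp.integral_integrand_eq_J hq0 hq1 hd₁ hd₂ hf hσ hcσ hd₁σ hd₂σ hAC ha hc hne hprod⟩⟩
  have hden : ∀ y ∈ QHyp.jDen c q k, y ∉ QHyp.Omega q := QHyp.q_mul_div_notMem_Omega hq0 hne k
  have hcard : Multiset.card (QHyp.jNum a c d₁ d₂ q k)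
      < Multiset.card (QHyp.jDen c q k) + 1 := by
    rwa [QHyp.card_jNum, QHyp.card_jDen_add_one]
  obtain ⟨s, hs⟩ := Nat.exists_eq_add_of_lt hcard
  exact ⟨fun x => (QHyp.summable_norm_phiTerm hq0 hq1 (s := s + 1) hs.symm hden (by simp)).of_norm,
    QHyp.differentiable_phi hq0 hq1 hcard hden⟩
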